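/- Let $M$ be a smooth manifold of dimension $n\ge 0$, let $q\in\{0,1,2,n-1,n\}$ with $q\ge 0$, and let $\zeta$ be a smooth differential $q$-form on $M$. Suppose that $\zeta$ is closed, $d\zeta=0$, and algebraically constant, that is, for any two points $x,y\in M$ there is a linear isomorphism $T_xM\to T_yM$ sending $\zeta_x$ to $\zeta_y$. Then $\zeta$ is locally constant: around every point of $M$ there are smooth local coordinates $x^1,\dots,x^n$ in which all the components $\zeta(\partial_{i_1},\dots,\partial_{i_q})$ of $\zeta$ are constant functions. -/

import Mathlib

open scoped Manifold ContDiff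

/-- A (not necessarily smooth) field of alternating `q`-linear forms on the tangent spaces of a
manifold `M` modelled on `ℝⁿ`. Linear forms on the finite-dimensional tangent spaces are
automatically continuous. -/
abbrev FormField (n q : ℕ) (M : Type*) [TopologicalSpace M]
    [ChartedSpace (EuclideanSpace ℝ (Fin n)) M] :=
  ∀ x : M, (TangentSpace (𝓡 n) x) [⋀^Fin q]→L[ℝ] ℝ

namespace FormField

variable {n q : ℕ} {M : Type*} [TopologicalSpace M] [ChartedSpace (EuclideanSpace ℝ (Fin n)) M]

/-- The expression of `ζ` in local coordinates `φ`: the pullback of `ζ` under the inverse of `φ`,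
a form on the open set `φ.target ⊆ ℝⁿ`. It is meaningful only at points of `φ.target`. -/
noncomputable def inCoordinates (ζ : FormField n q M)
    (φ : OpenPartialHomeomorph M (EuclideanSpace ℝ (Fin n))) (y : EuclideanSpace ℝ (Fin n)) :
    (EuclideanSpace ℝ (Fin n)) [⋀^Fin q]→L[ℝ] ℝ :=
  (ζ (φ.symm y)).compContinuousLinearMap (mfderiv (𝓡 n) (𝓡 n) φ.symm y)

/-- The component `ζ_{i₁ … i_q} = ζ(∂_{i₁}, …, ∂_{i_q})` of `ζ` in the local coordinates `φ`,
at the point with coordinates `y`. -/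
noncomputable def component (ζ : FormField n q M)
    (φ : OpenPartialHomeomorph M (EuclideanSpace ℝ (Fin n))) (i : Fin q → Fin n)
    (y : EuclideanSpace ℝ (Fin n)) : ℝ :=
  ζ.inCoordinates φ y (fun k => EuclideanSpace.single (i k) 1)

/-- `ζ` is smooth, that is, a differential `q`-form: its expression in every chart of the smooth
structure is smooth. -/
def IsSmooth (ζ : FormField n q M) : Prop :=
  ∀ φ ∈ IsManifold.maximalAtlas (𝓡 n) ∞ M, ContDiffOn ℝ ∞ (ζ.inCoordinates φ) φ.target

/-- `dζ = 0`, where the exterior derivative is computed in charts of the smooth structure. -/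
def IsClosed (ζ : FormField n q M) : Prop :=
  ∀ φ ∈ IsManifold.maximalAtlas (𝓡 n) ∞ M, ∀ y ∈ φ.target, extDeriv (ζ.inCoordinates φ) y = 0

/-- For any points `x` and `y`, some linear isomorphism `T_x M → T_y M` sends `ζ_x` to `ζ_y`. -/
def IsAlgebraicallyConstant (ζ : FormField n q M) : Prop :=
  ∀ x y : M, ∃ L : TangentSpace (𝓡 n) x ≃L[ℝ] TangentSpace (𝓡 n) y,
    (ζ x).compContinuousLinearMap
      (L.symm : TangentSpace (𝓡 n) y →L[ℝ] TangentSpace (𝓡 n) x) = ζ y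

/-- Around every point there are local coordinates, belonging to the smooth structure, in which
all components of `ζ` are constant. -/
def IsLocallyConstant (ζ : FormField n q M) : Prop :=
  ∀ x : M, ∃ φ ∈ IsManifold.maximalAtlas (𝓡 n) ∞ M, x ∈ φ.source ∧
    ∀ i : Fin q → Fin n, ∃ c : ℝ, ∀ y ∈ φ.target, ζ.component φ i y = c

end FormField

/-
Algebraic constancy makes the dimension of the kernel `{v | ζ(v, …) = 0}` constant, and one looks
for a local diffeomorphism of `ℝⁿ` that turns `ζ` into a constant form. A kernel vector field can
be straightened to a constant one, along which the closed form is then invariant; so the form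
descends to a hyperplane, which allows induction on `n`.
* `q = 0` is immediate, and a nonzero closed one-form is `du`, with `u` a coordinate.
* A nonzero top form becomes constant when a single coordinate is adjusted.
* A form of degree `n - 1` always has a kernel vector and so descends to a top form.
* A nondegenerate two-form `α` takes a constant value `b` on some vector field `X`. If `u` is a
  function with `du(X) = 1`, the closed form `α - du ∧ b` has constant rank and is degenerate, hence
  constant in suitable coordinates. These can be modified in the two remaining directions so that
  `u` and `b` become coordinates as well.
-/

open Filter Topology

section NormedSpace

variable {E F G H : Type*} [NormedAddCommGroup E] [NormedSpace ℝ E] [NormedAddCommGroup F]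
  [NormedSpace ℝ F] [NormedAddCommGroup G] [NormedSpace ℝ G] [NormedAddCommGroup H]
  [NormedSpace ℝ H]

/-- `f` is smooth in a neighbourhood of `x`. This is stronger than `ContDiffAt ℝ ∞ f x`, for which
the neighbourhood may shrink with the order of differentiability. -/
def SmoothNear (f : E → F) (x : E) : Prop :=
  ∀ᶠ z in 𝓝 x, ContDiffAt ℝ ∞ f z

namespace SmoothNear

variable {f g : E → F} {x : E}

theorem contDiffAt (hf : SmoothNear f x) : ContDiffAt ℝ ∞ f x := hf.self_of_nhds

theorem continuousAt (hf : SmoothNear f x) : ContinuousAt f x := hf.contDiffAt.continuousAt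

theorem differentiableAt (hf : SmoothNear f x) : DifferentiableAt ℝ f x :=
  hf.contDiffAt.differentiableAt (by simp)

theorem eventually_smoothNear (hf : SmoothNear f x) : ∀ᶠ z in 𝓝 x, SmoothNear f z :=
  eventually_eventually_nhds.2 hf

theorem eventually_differentiableAt (hf : SmoothNear f x) :
    ∀ᶠ z in 𝓝 x, DifferentiableAt ℝ f z :=
  hf.eventually_smoothNear.mono fun _ => differentiableAt

theorem of_contDiff (hf : ContDiff ℝ ∞ f) : SmoothNear f x :=
  .of_forall fun _ => hf.contDiffAt

theorem const (c : F) : SmoothNear (fun _ : E => c) x := of_contDiff contDiff_const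

theorem congr (hf : SmoothNear f x) (h : g =ᶠ[𝓝 x] f) : SmoothNear g x := by
  filter_upwards [hf, eventually_eventually_nhds.2 h] with z hz hz'
  exact hz.congr_of_eventuallyEq hz'

theorem comp {h : F → G} (hh : SmoothNear h (f x)) (hf : SmoothNear f x) :
    SmoothNear (fun z => h (f z)) x := by
  filter_upwards [hf, hf.continuousAt.eventually hh] with z hz hz'
  exact hz'.comp z hz

theorem fderiv (hf : SmoothNear f x) : SmoothNear (fderiv ℝ f) x :=
  hf.mono fun _ hz => hz.fderiv_right (by simp)

theorem add (hf : SmoothNear f x) (hg : SmoothNear g x) : SmoothNear (fun z => f z + g z) x :=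
  hf.mp (hg.mono fun _ h₂ h₁ => h₁.add h₂)

theorem sub (hf : SmoothNear f x) (hg : SmoothNear g x) : SmoothNear (fun z => f z - g z) x :=
  hf.mp (hg.mono fun _ h₂ h₁ => h₁.sub h₂)

theorem clm_apply {A : E → F →L[ℝ] G} (hA : SmoothNear A x) (hf : SmoothNear f x) :
    SmoothNear (fun z => A z (f z)) x :=
  hA.mp (hf.mono fun _ h₂ h₁ => h₁.clm_apply h₂)

theorem clm_comp {A : E → F →L[ℝ] G} {B : E → H →L[ℝ] F} (hA : SmoothNear A x)
    (hB : SmoothNear B x) : SmoothNear (fun z => (A z).comp (B z)) x :=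
  hA.mp (hB.mono fun _ h₂ h₁ => h₁.clm_comp h₂)

theorem exists_contDiff_eventuallyEq [FiniteDimensional ℝ E] (hf : SmoothNear f x) :
    ∃ g : E → F, ContDiff ℝ ∞ g ∧ g =ᶠ[𝓝 x] f := by
  obtain ⟨r, hr, h⟩ := Metric.eventually_nhds_iff_ball.1 hf
  let b : ContDiffBump x := ⟨r / 4, r / 2, by linarith, by linarith⟩
  refine ⟨fun z => b z • f z, contDiff_iff_contDiffAt.2 fun z => ?_, ?_⟩
  · by_cases hz : z ∈ Metric.ball x r
    · exact b.contDiffAt.smul (h z hz)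
    · have hz' : z ∉ tsupport b := by
        rw [b.tsupport_eq]
        exact fun hz' => hz (Metric.closedBall_subset_ball (half_lt_self hr) hz')
      refine contDiffAt_const (c := 0) |>.congr_of_eventuallyEq ?_
      filter_upwards [notMem_tsupport_iff_eventuallyEq.1 hz'] with w hw
      simp [hw]
  · filter_upwards [b.eventuallyEq_one] with z hz
    simp [hz]

end SmoothNear

theorem eventually_isInvertible [CompleteSpace E] {X : Type*} [TopologicalSpace X]
    {A : X → E →L[ℝ] F} {x : X} (hA : ContinuousAt A x) (hx : (A x).IsInvertible) :
    ∀ᶠ z in 𝓝 x, (A z).IsInvertible := by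
  obtain ⟨L, hL⟩ := hx
  exact hA.eventually (hL ▸ L.nhds)

namespace SmoothNear

variable {f : E → F} {x : E}

theorem inverse [CompleteSpace F] {A : E → F →L[ℝ] G} (hA : SmoothNear A x)
    (hx : (A x).IsInvertible) : SmoothNear (fun z => (A z).inverse) x := by
  filter_upwards [hA, eventually_isInvertible hA.continuousAt hx] with z hz hz'
  exact hz'.contDiffAt_map_inverse.comp z hz

variable [CompleteSpace E]

theorem exists_openPartialHomeomorph (hf : SmoothNear f x)
    (hx : (_root_.fderiv ℝ f x).IsInvertible) :
    ∃ e : OpenPartialHomeomorph E F, x ∈ e.source ∧ e = f ∧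
      ContDiffOn ℝ ∞ e e.source ∧ ContDiffOn ℝ ∞ e.symm e.target := by
  obtain ⟨U, hU, hUo, hxU⟩ :=
    eventually_nhds_iff.1 (hf.and (eventually_isInvertible hf.fderiv.continuousAt hx))
  obtain ⟨L, hL⟩ := hx
  have hfL : HasFDerivAt f (L : E →L[ℝ] F) x := hL ▸ hf.differentiableAt.hasFDerivAt
  let e := (hf.contDiffAt.toOpenPartialHomeomorph f hfL (by simp)).restrOpen U hUo
  refine ⟨e, ⟨hf.contDiffAt.mem_toOpenPartialHomeomorph_source hfL (by simp), hxU⟩, rfl,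
    fun z hz => (hU z hz.2).1.contDiffWithinAt, fun w hw => ?_⟩
  obtain ⟨hsmooth, L', hL'⟩ := hU _ (e.map_target hw).2
  have hfL' : HasFDerivAt f (L' : E →L[ℝ] F) (e.symm w) :=
    hL' ▸ (hsmooth.differentiableAt (by simp)).hasFDerivAt
  exact (e.contDiffAt_symm hw hfL' hsmooth).contDiffWithinAt

theorem exists_localInverse (hf : SmoothNear f x) (hx : (_root_.fderiv ℝ f x).IsInvertible) :
    ∃ g : F → E, SmoothNear g (f x) ∧ (∀ᶠ z in 𝓝 x, g (f z) = z) ∧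
      ∀ᶠ w in 𝓝 (f x), f (g w) = w := by
  obtain ⟨e, hxe, rfl, -, hsymm⟩ := hf.exists_openPartialHomeomorph hx
  have htarget := e.open_target.mem_nhds (e.map_source hxe)
  refine ⟨e.symm, ?_, e.eventually_left_inverse hxe,
    e.eventually_right_inverse (e.map_source hxe)⟩
  filter_upwards [eventually_mem_nhds_iff.2 htarget] with w hw
  exact hsymm.contDiffAt hw

end SmoothNear

theorem eventually_fderiv_comp_eq_id {f : E → F} {g : F → E} {x : E} (hf : SmoothNear f x)
    (hg : SmoothNear g (f x)) (hgf : ∀ᶠ z in 𝓝 x, g (f z) = z) :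
    ∀ᶠ z in 𝓝 x, (fderiv ℝ g (f z)).comp (fderiv ℝ f z) = .id ℝ E := by
  filter_upwards [hf.eventually_differentiableAt, eventually_eventually_nhds.2 hgf,
    hf.continuousAt.eventually hg.eventually_differentiableAt] with z hfz hgfz hgz
  exact (hgz.hasFDerivAt.comp z hfz.hasFDerivAt).unique
    ((hasFDerivAt_id z).congr_of_eventuallyEq hgfz)

section Nemytskii

universe u

variable {K : Type*} [TopologicalSpace K] [CompactSpace K] {V : Type u} [NormedAddCommGroup V]
  [NormedSpace ℝ V]

/-- Pointwise application of a continuous family of operators to a continuous function. -/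
noncomputable def pointwiseApply (K : Type*) [TopologicalSpace K] [CompactSpace K] (E F : Type*)
    [NormedAddCommGroup E] [NormedSpace ℝ E] [NormedAddCommGroup F] [NormedSpace ℝ F] :
    C(K, E →L[ℝ] F) →L[ℝ] C(K, E) →L[ℝ] C(K, F) :=
  LinearMap.mkContinuous₂
    (LinearMap.mk₂ ℝ
      (fun (A : C(K, E →L[ℝ] F)) (γ : C(K, E)) => (⟨fun s => A s (γ s), by fun_prop⟩ : C(K, F)))
      (fun _ _ _ => by ext; simp) (fun _ _ _ => by ext; simp)
      (fun _ _ _ => by ext; simp) (fun _ _ _ => by ext; simp)) 1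
    (fun A γ => by
      rw [one_mul, ContinuousMap.norm_le _ (by positivity)]
      exact fun s => (A s).le_of_opNorm_le_of_le (A.norm_coe_le_norm s) (γ.norm_coe_le_norm s))

theorem norm_comp_sub_comp_sub_le {X : C(E, F)} (hX : Differentiable ℝ X) {γ η : C(K, E)}
    {ε : ℝ} (hε : 0 ≤ ε)
    (h : ∀ s, ∀ w ∈ segment ℝ (γ s) (η s), ‖fderiv ℝ X w - fderiv ℝ X (γ s)‖ ≤ ε)
    (A : C(K, E →L[ℝ] F)) (hA : ∀ s, A s = fderiv ℝ X (γ s)) :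
    ‖X.comp η - X.comp γ - pointwiseApply K E F A (η - γ)‖ ≤ ε * ‖η - γ‖ := by
  refine (ContinuousMap.norm_le _ (by positivity)).2 fun s => ?_
  have hs := (convex_segment (γ s) (η s)).norm_image_sub_le_of_norm_hasFDerivWithin_le'
    (fun w _ => (hX w).hasFDerivAt.hasFDerivWithinAt) (h s)
    (left_mem_segment ℝ _ _) (right_mem_segment ℝ _ _)
  rw [← hA] at hs
  exact hs.trans (mul_le_mul_of_nonneg_left ((η - γ).norm_coe_le_norm s) hε)

theorem hasFDerivAt_comp_continuousMap {X : E → F} (hX : ContDiff ℝ 1 X) (γ : C(K, E)) :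
    HasFDerivAt (fun γ : C(K, E) => (⟨X, hX.continuous⟩ : C(E, F)).comp γ)
      (pointwiseApply K E F
        ((⟨fderiv ℝ X, hX.continuous_fderiv (by simp)⟩ : C(E, E →L[ℝ] F)).comp γ)) γ := by
  rw [hasFDerivAt_iff_isLittleO, Asymptotics.isLittleO_iff]
  intro ε hε
  have hX' := ContinuousMap.continuous_postcomp (X := K)
    (⟨fderiv ℝ X, hX.continuous_fderiv (by simp)⟩ : C(E, E →L[ℝ] F))
  obtain ⟨δ, hδ, hball⟩ :=
    (Metric.continuous_iff (α := C(K, E)) (β := C(K, E →L[ℝ] F))).1 hX' γ ε hε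
  filter_upwards [Metric.ball_mem_nhds γ hδ] with η hη
  refine norm_comp_sub_comp_sub_le (X := ⟨X, hX.continuous⟩) (hX.differentiable (by simp)) hε.le
    (fun s w hw => ?_) _ fun _ => rfl
  obtain ⟨θ, hθ, rfl⟩ := segment_eq_image_lineMap ℝ (γ s) (η s) ▸ hw
  have hseg := (convex_ball γ δ).lineMap_mem (Metric.mem_ball_self hδ) hη hθ
  have hval : AffineMap.lineMap (γ s) (η s) θ = (AffineMap.lineMap γ η θ : C(K, E)) s := by
    simp only [AffineMap.lineMap_apply, vsub_eq_sub, vadd_eq_add, ContinuousMap.add_apply,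
      ContinuousMap.smul_apply, ContinuousMap.sub_apply]
  rw [← dist_eq_norm, hval]
  exact (ContinuousMap.dist_apply_le_dist s).trans (hball _ hseg).le

theorem contDiff_nat_comp_continuousMap (n : ℕ) : ∀ {W : Type u} [NormedAddCommGroup W]
    [NormedSpace ℝ W] {X : V → W} (hX : ContDiff ℝ n X),
    ContDiff ℝ n (fun γ : C(K, V) => (⟨X, hX.continuous⟩ : C(V, W)).comp γ) := by
  induction n with
  | zero => exact fun hX => contDiff_zero.2 (ContinuousMap.continuous_postcomp _)
  | succ n ih =>
    intro W _ _ X hX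
    have hX₁ : ContDiff ℝ 1 X := hX.of_le (by norm_cast; omega)
    have hX' : ContDiff ℝ n (fderiv ℝ X) := hX.fderiv_right (by norm_cast)
    exact contDiff_succ_iff_hasFDerivAt.2
      ⟨_, (pointwiseApply K V W).contDiff.comp (ih hX'), hasFDerivAt_comp_continuousMap hX₁⟩

theorem contDiff_comp_continuousMap {W : Type u} [NormedAddCommGroup W] [NormedSpace ℝ W]
    {X : V → W} (hX : ContDiff ℝ ∞ X) :
    ContDiff ℝ ∞ (fun γ : C(K, V) => (⟨X, hX.continuous⟩ : C(V, W)).comp γ) :=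
  contDiff_infty.2 fun n => contDiff_nat_comp_continuousMap n (contDiff_infty.1 hX n)

end Nemytskii

section Flow

/-- The operator `γ ↦ (s ↦ ∫₀ˢ γ)` on continuous functions on the unit interval. -/
noncomputable def volterra (E : Type*) [NormedAddCommGroup E] [NormedSpace ℝ E] :
    C(Set.Icc (0 : ℝ) 1, E) →L[ℝ] C(Set.Icc (0 : ℝ) 1, E) :=
  LinearMap.mkContinuous
    { toFun := fun γ => ⟨fun s => ∫ r in (0 : ℝ)..s, γ (Set.projIcc 0 1 zero_le_one r),
        (intervalIntegral.continuous_primitive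
          (fun a b => Continuous.intervalIntegrable (by fun_prop) a b) 0).comp
          continuous_subtype_val⟩
      map_add' := fun γ η => by
        ext s
        exact intervalIntegral.integral_add (Continuous.intervalIntegrable (by fun_prop) _ _)
          (Continuous.intervalIntegrable (by fun_prop) _ _)
      map_smul' := fun c γ => by
        ext s
        exact intervalIntegral.integral_smul _ _ } 1
    (fun γ => by
      rw [one_mul, ContinuousMap.norm_le _ (by positivity)]
      intro s
      have hint := intervalIntegral.norm_integral_le_of_norm_le_const (a := 0) (b := (s : ℝ))
        (f := fun r => γ (Set.projIcc 0 1 zero_le_one r)) (C := ‖γ‖)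
        (fun r _ => γ.norm_coe_le_norm _)
      refine hint.trans (mul_le_of_le_one_right (norm_nonneg _) ?_)
      rw [sub_zero, abs_of_nonneg s.2.1]
      exact s.2.2)

theorem volterra_apply (γ : C(Set.Icc (0 : ℝ) 1, E)) (s : Set.Icc (0 : ℝ) 1) :
    volterra E γ s = ∫ r in (0 : ℝ)..s, γ (Set.projIcc 0 1 zero_le_one r) := rfl

/-- The curve `r ↦ γ (s r)`. -/
noncomputable def rescale (s : Set.Icc (0 : ℝ) 1) (γ : C(Set.Icc (0 : ℝ) 1, E)) :
    C(Set.Icc (0 : ℝ) 1, E) :=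
  ⟨fun r => γ (s * r), by fun_prop⟩

theorem volterra_rescale (s : Set.Icc (0 : ℝ) 1) (γ : C(Set.Icc (0 : ℝ) 1, E)) :
    (s : ℝ) • volterra E (rescale s γ) = rescale s (volterra E γ) := by
  ext r
  have hcongr : ∀ u ∈ Set.uIcc (0 : ℝ) r, rescale s γ (Set.projIcc 0 1 zero_le_one u) =
      γ (Set.projIcc 0 1 zero_le_one (s * u)) := by
    intro u hu
    rw [Set.uIcc_of_le r.2.1] at hu
    have hu' : u ∈ Set.Icc (0 : ℝ) 1 := ⟨hu.1, hu.2.trans r.2.2⟩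
    have hsu : (s : ℝ) * u ∈ Set.Icc (0 : ℝ) 1 := (s * ⟨u, hu'⟩ : Set.Icc (0 : ℝ) 1).2
    rw [Set.projIcc_of_mem _ hu', Set.projIcc_of_mem _ hsu]
    rfl
  have hsub := intervalIntegral.smul_integral_comp_mul_left (a := 0) (b := (r : ℝ))
    (fun u => γ (Set.projIcc 0 1 zero_le_one u)) (s : ℝ)
  rw [mul_zero] at hsub
  rw [ContinuousMap.smul_apply, volterra_apply, intervalIntegral.integral_congr hcongr]
  exact hsub

/-- The embedding of `E` into the curves in `E` as the constant curves. -/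
noncomputable def constCurve : E →L[ℝ] C(Set.Icc (0 : ℝ) 1, E) where
  toFun := ContinuousMap.const _
  map_add' _ _ := rfl
  map_smul' _ _ := rfl
  cont := ContinuousMap.continuous_const'

/-- The Picard map `(t, γ) ↦ (t, γ - t ∫ V ∘ γ)`. The curve `s ↦ γ s` satisfies `γ' = t V(γ)` and
`γ 0 = y` if and only if `(t, γ)` is sent to `(t, y)`. -/
noncomputable def picardMap (V : C(E, E)) (p : ℝ × C(Set.Icc (0 : ℝ) 1, E)) :
    ℝ × C(Set.Icc (0 : ℝ) 1, E) :=
  (p.1, p.2 - p.1 • volterra E (V.comp p.2))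

theorem picardMap_zero (V : C(E, E)) (γ : C(Set.Icc (0 : ℝ) 1, E)) :
    picardMap V (0, γ) = (0, γ) := by
  simp only [picardMap, zero_smul, sub_zero]

theorem picardMap_rescale {V : C(E, E)} {t : ℝ} {γ : C(Set.Icc (0 : ℝ) 1, E)} {y : E}
    (h : picardMap V (t, γ) = (t, constCurve y)) (s : Set.Icc (0 : ℝ) 1) :
    picardMap V (s * t, rescale s γ) = (s * t, constCurve y) := by
  refine Prod.ext rfl ?_
  have hcomp : V.comp (rescale s γ) = rescale s (V.comp γ) := rfl
  change rescale s γ - ((s : ℝ) * t) • volterra E (V.comp (rescale s γ)) = constCurve y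
  rw [mul_comm, mul_smul, hcomp, volterra_rescale]
  ext r
  exact congrArg (fun η : C(Set.Icc (0 : ℝ) 1, E) => η (s * r)) (congrArg Prod.snd h)

theorem contDiff_volterra_comp {V : E → E} (hV : ContDiff ℝ ∞ V) :
    ContDiff ℝ ∞ fun γ => volterra E ((⟨V, hV.continuous⟩ : C(E, E)).comp γ) :=
  (volterra E).contDiff.comp (contDiff_comp_continuousMap hV)

theorem contDiff_picardMap {V : E → E} (hV : ContDiff ℝ ∞ V) :
    ContDiff ℝ ∞ (picardMap (⟨V, hV.continuous⟩ : C(E, E))) :=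
  contDiff_fst.prodMk
    (contDiff_snd.sub (contDiff_fst.smul ((contDiff_volterra_comp hV).comp contDiff_snd)))

theorem isInvertible_fderiv_picardMap {V : E → E} (hV : ContDiff ℝ ∞ V)
    (γ : C(Set.Icc (0 : ℝ) 1, E)) :
    (fderiv ℝ (picardMap (⟨V, hV.continuous⟩ : C(E, E))) (0, γ)).IsInvertible := by
  let J : C(Set.Icc (0 : ℝ) 1, E) → C(Set.Icc (0 : ℝ) 1, E) := fun γ =>
    volterra E ((⟨V, hV.continuous⟩ : C(E, E)).comp γ)
  have hJ : HasFDerivAt (fun p : ℝ × C(Set.Icc (0 : ℝ) 1, E) => J p.2)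
      ((fderiv ℝ J γ).comp (.snd ℝ ℝ _)) (0, γ) :=
    HasFDerivAt.comp (g := J) (0, γ)
      ((contDiff_volterra_comp hV).differentiable (by simp) γ).hasFDerivAt hasFDerivAt_snd
  refine ⟨.skewProd (.refl ℝ ℝ) (.refl ℝ _) (.toSpanSingleton ℝ (-J γ)), Eq.symm ?_⟩
  refine HasFDerivAt.fderiv ((hasFDerivAt_fst.prodMk
    (hasFDerivAt_snd.sub (hasFDerivAt_fst.smul hJ))).congr_fderiv ?_)
  exact ContinuousLinearMap.ext fun p => Prod.ext rfl (by simp [sub_eq_add_neg])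

theorem rescale_mem_ball {t ρ : ℝ} {γ : C(Set.Icc (0 : ℝ) 1, E)} {x : E}
    (h : (t, γ) ∈ Metric.ball ((0 : ℝ), constCurve x) ρ) (s : Set.Icc (0 : ℝ) 1) :
    ((s : ℝ) * t, rescale s γ) ∈ Metric.ball ((0 : ℝ), constCurve x) ρ := by
  obtain ⟨ht, hγ⟩ := max_lt_iff.1 (Metric.mem_ball.1 h)
  have ht' : dist ((s : ℝ) * t) 0 ≤ dist t 0 := by
    rw [dist_zero_right, dist_zero_right, norm_mul, Real.norm_of_nonneg s.2.1]
    exact mul_le_of_le_one_left (norm_nonneg _) s.2.2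
  have hγ' : dist (rescale s γ) (constCurve x) ≤ dist γ (constCurve x) :=
    (ContinuousMap.dist_le dist_nonneg).2 fun r =>
      ContinuousMap.dist_apply_le_dist (f := γ) (g := constCurve x) (s * r)
  exact max_lt (ht'.trans_lt ht) (hγ'.trans_lt hγ)

theorem exists_picard_family [CompleteSpace E] {V : E → E} (hV : ContDiff ℝ ∞ V) (x : E) :
    ∃ Γ : ℝ × E → C(Set.Icc (0 : ℝ) 1, E), SmoothNear Γ (0, x) ∧
      ∀ᶠ p in 𝓝 ((0 : ℝ), x),
        Γ p = constCurve p.2 + p.1 • volterra E ((⟨V, hV.continuous⟩ : C(E, E)).comp (Γ p)) ∧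
        ∀ s : Set.Icc (0 : ℝ) 1, Γ (s * p.1, p.2) = rescale s (Γ p) := by
  have hfix := picardMap_zero (⟨V, hV.continuous⟩ : C(E, E)) (constCurve x)
  obtain ⟨g, hg, hgΨ, hΨg⟩ := (SmoothNear.of_contDiff (contDiff_picardMap hV)).exists_localInverse
    (isInvertible_fderiv_picardMap hV (constCurve x))
  rw [hfix] at hg hΨg
  have hgx := hgΨ.self_of_nhds
  rw [hfix] at hgx
  let ι : ℝ × E → ℝ × C(Set.Icc (0 : ℝ) 1, E) := fun p => (p.1, constCurve p.2)
  have hι : ContDiff ℝ ∞ ι := contDiff_fst.prodMk ((constCurve (E := E)).contDiff.comp contDiff_snd)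
  have hgι : SmoothNear (fun p => g (ι p)) (0, x) := .comp hg (.of_contDiff hι)
  obtain ⟨ρ, hρ, hball⟩ := Metric.eventually_nhds_iff_ball.1 hgΨ
  have hnear : ∀ᶠ p in 𝓝 ((0 : ℝ), x), g (ι p) ∈ Metric.ball (0, constCurve x) ρ :=
    hgι.continuousAt.eventually (hgx.symm ▸ Metric.ball_mem_nhds _ hρ)
  refine ⟨fun p => (g (ι p)).2, .comp (.of_contDiff contDiff_snd) hgι, ?_⟩
  filter_upwards [hι.continuous.continuousAt.eventually hΨg, hnear] with ⟨t, y⟩ hΨ hmem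
  generalize hq : g (ι (t, y)) = q at *
  obtain ⟨t', γ⟩ := q
  obtain rfl : t' = t := congrArg Prod.fst hΨ
  refine ⟨sub_eq_iff_eq_add.1 (congrArg Prod.snd hΨ), fun s => ?_⟩
  have hinv := hball _ (rescale_mem_ball hmem s)
  rw [picardMap_rescale hΨ s] at hinv
  exact congrArg Prod.snd hinv

theorem eq_zero_of_eventually_smul_eq_zero {X : Type*} [TopologicalSpace X] {g : ℝ × X → F}
    {p : ℝ × X} (hg : ContinuousAt g p) (h : ∀ᶠ p' in 𝓝 p, p'.1 • g p' = 0) : g p = 0 := by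
  by_cases hp : p.1 = 0
  · have hline : Tendsto (fun t : ℝ => (t, p.2)) (𝓝[≠] 0) (𝓝 p) := by
      have hcont : Continuous fun t : ℝ => (t, p.2) := by fun_prop
      have htendsto := (hcont.tendsto 0).mono_left (nhdsWithin_le_nhds (s := {0}ᶜ))
      rwa [show ((0 : ℝ), p.2) = p from Prod.ext hp.symm rfl] at htendsto
    refine tendsto_nhds_unique (hg.tendsto.comp hline) (tendsto_const_nhds.congr' ?_)
    filter_upwards [hline.eventually h, self_mem_nhdsWithin] with t ht ht0
    exact ((smul_eq_zero.1 ht).resolve_left ht0).symm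
  · exact (smul_eq_zero.1 h.self_of_nhds).resolve_left hp

theorem smul_fderiv_eq_of_volterra [CompleteSpace E] {V : C(E, E)} {Φ : ℝ × E → E} {t : ℝ} {y : E}
    {γ : C(Set.Icc (0 : ℝ) 1, E)} (hΦ : DifferentiableAt ℝ Φ (t, y))
    (hγ : γ = constCurve y + t • volterra E (V.comp γ))
    (hΦγ : ∀ s : Set.Icc (0 : ℝ) 1, Φ (s * t, y) = γ s) :
    t • fderiv ℝ Φ (t, y) (1, 0) = t • V (Φ (t, y)) := by
  have hchain : HasDerivAt (fun s : ℝ => Φ (s * t, y)) (fderiv ℝ Φ (t, y) (t, 0)) 1 := by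
    have hline : HasDerivAt (fun s : ℝ => (s * t, y)) (t, 0) 1 := by
      simpa using ((hasDerivAt_id (1 : ℝ)).mul_const t).prodMk (hasDerivAt_const (1 : ℝ) y)
    have hΦ' : HasFDerivAt Φ (fderiv ℝ Φ (t, y)) (1 * t, y) := by
      simpa only [one_mul] using hΦ.hasFDerivAt
    exact hΦ'.comp_hasDerivAt 1 hline
  have hint : HasDerivWithinAt (fun s : ℝ => Φ (s * t, y)) (t • V (Φ (t, y)))
      (Set.Icc 0 1) 1 := by
    have hcont : Continuous fun r : ℝ => V (γ (Set.projIcc 0 1 zero_le_one r)) := by fun_prop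
    have hprim := (((hcont.integral_hasStrictDerivAt 0 1).hasDerivAt.const_smul t).const_add y)
    have hend : Φ (t, y) = γ (Set.projIcc 0 1 zero_le_one (1 : ℝ)) := by
      have hΦ₁ := hΦγ 1
      rw [Set.Icc.coe_one, one_mul] at hΦ₁
      rw [Set.projIcc_right]
      exact hΦ₁
    rw [hend]
    refine hprim.hasDerivWithinAt.congr_of_mem (fun s hs => ?_) (Set.right_mem_Icc.2 zero_le_one)
    exact (hΦγ ⟨s, hs⟩).trans (congrArg (fun η : C(Set.Icc (0 : ℝ) 1, E) => η ⟨s, hs⟩) hγ)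
  have hunique := (uniqueDiffOn_Icc (zero_lt_one' ℝ) 1 (Set.right_mem_Icc.2 zero_le_one)).eq_deriv
    _ hchain.hasDerivWithinAt hint
  rwa [show ((t, 0) : ℝ × E) = t • (1, 0) by simp, map_smul] at hunique

theorem exists_flow_of_contDiff [CompleteSpace E] {V : E → E} (hV : ContDiff ℝ ∞ V) (x : E) :
    ∃ Φ : ℝ × E → E, SmoothNear Φ (0, x) ∧ (∀ᶠ y in 𝓝 x, Φ (0, y) = y) ∧
      ∀ᶠ p in 𝓝 ((0 : ℝ), x), fderiv ℝ Φ p (1, 0) = V (Φ p) := by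
  obtain ⟨Γ, hΓ, hpicard⟩ := exists_picard_family hV x
  let Φ : ℝ × E → E := fun p => Γ p 1
  have hΦ : SmoothNear Φ (0, x) :=
    .comp (.of_contDiff (ContinuousMap.evalCLM ℝ (1 : Set.Icc (0 : ℝ) 1)).contDiff) hΓ
  refine ⟨Φ, hΦ, ?_, ?_⟩
  · filter_upwards [(Continuous.prodMk_right (0 : ℝ)).continuousAt.eventually hpicard] with y hy
    change Γ (0, y) 1 = y
    rw [hy.1, zero_smul, add_zero]
    rfl
  · have hsmul : ∀ᶠ p in 𝓝 ((0 : ℝ), x), p.1 • (fderiv ℝ Φ p (1, 0) - V (Φ p)) = 0 := by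
      filter_upwards [hpicard, hΦ.eventually_differentiableAt] with ⟨t, y⟩ ⟨hγ, hresc⟩ hdiff
      have hΦγ : ∀ s : Set.Icc (0 : ℝ) 1, Φ (s * t, y) = Γ (t, y) s := fun s => by
        change Γ (s * t, y) 1 = _
        rw [hresc s]
        exact congrArg (Γ (t, y)) (mul_one s)
      rw [smul_sub, smul_fderiv_eq_of_volterra hdiff hγ hΦγ]
      exact sub_self _
    filter_upwards [eventually_eventually_nhds.2 hsmul, hΦ.eventually_smoothNear] with p hp hs
    exact sub_eq_zero.1 (eq_zero_of_eventually_smul_eq_zero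
      ((hs.fderiv.continuousAt.clm_apply continuousAt_const).sub
        (hV.continuous.continuousAt.comp hs.continuousAt)) hp)

theorem SmoothNear.exists_flow [FiniteDimensional ℝ E] {X : E → E} {x : E}
    (hX : SmoothNear X x) :
    ∃ Φ : ℝ × E → E, SmoothNear Φ (0, x) ∧ (∀ᶠ y in 𝓝 x, Φ (0, y) = y) ∧
      ∀ᶠ p in 𝓝 ((0 : ℝ), x), _root_.fderiv ℝ Φ p (1, 0) = X (Φ p) := by
  have : CompleteSpace E := FiniteDimensional.complete ℝ E
  obtain ⟨V, hV, hVX⟩ := hX.exists_contDiff_eventuallyEq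
  obtain ⟨Φ, hΦ, hinit, hflow⟩ := exists_flow_of_contDiff hV x
  have hΦX : ∀ᶠ p in 𝓝 ((0 : ℝ), x), V (Φ p) = X (Φ p) :=
    hΦ.continuousAt.eventually (hinit.self_of_nhds.symm ▸ hVX)
  exact ⟨Φ, hΦ, hinit, by filter_upwards [hflow, hΦX] with p hp hp' using hp.trans hp'⟩

end Flow

section Straightening

/-- The projection along `v` onto the affine hyperplane through `x` parallel to `ker ℓ`; it is a
projection if `ℓ v = 1`. -/
def hyperplaneProj (ℓ : E →L[ℝ] ℝ) (v x z : E) : E := z - ℓ (z - x) • v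

theorem contDiff_hyperplaneProj (ℓ : E →L[ℝ] ℝ) (v x : E) :
    ContDiff ℝ ∞ (hyperplaneProj ℓ v x) := by
  unfold hyperplaneProj
  fun_prop

theorem hyperplaneProj_self (ℓ : E →L[ℝ] ℝ) (v x : E) : hyperplaneProj ℓ v x x = x := by
  simp only [hyperplaneProj, sub_self, map_zero, zero_smul, sub_zero]

theorem hasFDerivAt_hyperplaneProj (ℓ : E →L[ℝ] ℝ) (v x z : E) :
    HasFDerivAt (hyperplaneProj ℓ v x) (.id ℝ E - ℓ.smulRight v) z :=
  (hasFDerivAt_id z).sub ((ℓ.hasFDerivAt.comp z ((hasFDerivAt_id z).sub_const x)).smul_const v)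

theorem fderiv_flow {Φ : ℝ × E → E} {x : E} (hΦ : DifferentiableAt ℝ Φ (0, x))
    (hinit : ∀ᶠ y in 𝓝 x, Φ (0, y) = y) :
    fderiv ℝ Φ (0, x) = (ContinuousLinearMap.toSpanSingleton ℝ (fderiv ℝ Φ (0, x) (1, 0))).coprod
      (.id ℝ E) := by
  have hslice : HasFDerivAt (fun y => Φ (0, y)) ((fderiv ℝ Φ (0, x)).comp (.inr ℝ ℝ E)) x :=
    HasFDerivAt.comp x (f := fun y : E => ((0 : ℝ), y)) hΦ.hasFDerivAt
      (hasFDerivAt_prodMk_right (0 : ℝ) x)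
  have hid := hslice.unique ((hasFDerivAt_id x).congr_of_eventuallyEq hinit)
  rw [← hid]
  ext <;> simp

theorem SmoothNear.exists_straightening [FiniteDimensional ℝ E] {X : E → E} {x : E}
    (hX : SmoothNear X x) (hx : X x ≠ 0) :
    ∃ f g : E → E, f x = x ∧ g x = x ∧ SmoothNear f x ∧ SmoothNear g x ∧
      (∀ᶠ z in 𝓝 x, g (f z) = z) ∧ (∀ᶠ z in 𝓝 x, f (g z) = z) ∧
      ∀ᶠ z in 𝓝 x, _root_.fderiv ℝ f z (X x) = X (f z) := by
  have : CompleteSpace E := FiniteDimensional.complete ℝ E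
  obtain ⟨ℓ, hℓ⟩ := SeparatingDual.exists_eq_one (R := ℝ) hx
  obtain ⟨Φ, hΦ, hinit, hflow⟩ := hX.exists_flow
  let A : E → ℝ × E := fun z => (ℓ (z - x), hyperplaneProj ℓ (X x) x z)
  have hAx : A x = (0, x) := by
    simp only [A, sub_self, map_zero, hyperplaneProj_self]
  have hA : ContDiff ℝ ∞ A :=
    (ℓ.contDiff.comp (contDiff_id.sub contDiff_const)).prodMk (contDiff_hyperplaneProj ℓ _ x)
  have hA' : ∀ z, HasFDerivAt A (ℓ.prod (.id ℝ E - ℓ.smulRight (X x))) z := fun z =>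
    (ℓ.hasFDerivAt.comp z ((hasFDerivAt_id z).sub_const x)).prodMk
      (hasFDerivAt_hyperplaneProj ℓ _ x z)
  have hAt : Tendsto A (𝓝 x) (𝓝 (0, x)) := hAx ▸ hA.continuous.tendsto x
  have hf : SmoothNear (fun z => Φ (A z)) x := .comp (hAx ▸ hΦ) (.of_contDiff hA)
  have hfx : Φ (A x) = x := by rw [hAx, hinit.self_of_nhds]
  have hf' : ∀ᶠ z in 𝓝 x, _root_.fderiv ℝ (fun z => Φ (A z)) z =
      (_root_.fderiv ℝ Φ (A z)).comp (ℓ.prod (.id ℝ E - ℓ.smulRight (X x))) :=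
    (hAt.eventually hΦ.eventually_differentiableAt).mono fun z hz =>
      (hz.hasFDerivAt.comp z (hA' z)).fderiv
  have hid : _root_.fderiv ℝ (fun z => Φ (A z)) x = .id ℝ E := by
    rw [hf'.self_of_nhds, hAx, fderiv_flow hΦ.differentiableAt hinit, hflow.self_of_nhds,
      hinit.self_of_nhds]
    ext w
    simp
  obtain ⟨g, hg, hgf, hfg⟩ :=
    hf.exists_localInverse (hid ▸ ⟨ContinuousLinearEquiv.refl ℝ E, rfl⟩)
  rw [hfx] at hg hfg
  refine ⟨_, g, hfx, ?_, hf, hg, hgf, hfg, ?_⟩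
  · simpa only [hfx] using hgf.self_of_nhds
  · filter_upwards [hf', hAt.eventually hflow] with z hz hz'
    rw [hz, ← hz']
    simp [hℓ]

theorem SmoothNear.exists_time_function [FiniteDimensional ℝ E] {X : E → E} {x : E}
    (hX : SmoothNear X x) (hx : X x ≠ 0) :
    ∃ u : E → ℝ, SmoothNear u x ∧ ∀ᶠ z in 𝓝 x, _root_.fderiv ℝ u z (X z) = 1 := by
  obtain ⟨ℓ, hℓ⟩ := SeparatingDual.exists_eq_one (R := ℝ) hx
  obtain ⟨f, g, hfx, hgx, hf, hg, hgf, hfg, hfX⟩ := hX.exists_straightening hx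
  have hgt : Tendsto g (𝓝 x) (𝓝 x) := by simpa only [hgx] using hg.continuousAt.tendsto
  refine ⟨fun z => ℓ (g z), .comp (.of_contDiff ℓ.contDiff) hg, ?_⟩
  filter_upwards [hgt.eventually (eventually_fderiv_comp_eq_id hf (hfx.symm ▸ hg) hgf),
    hgt.eventually hfX, hfg, hg.eventually_differentiableAt] with z hz hXz hfgz hgz
  rw [hfgz] at hz hXz
  have hu : HasFDerivAt (fun z => ℓ (g z)) (ℓ.comp (_root_.fderiv ℝ g z)) z :=
    ℓ.hasFDerivAt.comp z hgz.hasFDerivAt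
  rw [hu.fderiv, ← hXz]
  exact (congrArg ℓ (DFunLike.congr_fun hz (X x))).trans hℓ

end Straightening

section Smoothness

variable {ι : Type*} [Fintype ι]

theorem norm_alternatization_le [DecidableEq ι]
    (c : ContinuousMultilinearMap ℝ (fun _ : ι => E) F) :
    ‖ContinuousMultilinearMap.alternatization c‖ ≤ (Fintype.card ι).factorial * ‖c‖ := by
  refine ContinuousAlternatingMap.opNorm_le_bound _ (by positivity) fun v => ?_
  rw [ContinuousMultilinearMap.alternatization_apply_apply]
  have hterm : ∀ σ : Equiv.Perm ι,
      ‖Equiv.Perm.sign σ • c (v ∘ σ)‖ ≤ ‖c‖ * ∏ i, ‖v i‖ := fun σ => by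
    have hsign : ‖Equiv.Perm.sign σ • c (v ∘ σ)‖ = ‖c (v ∘ σ)‖ := by
      obtain h | h := Int.units_eq_one_or (Equiv.Perm.sign σ) <;> simp [h]
    rw [hsign]
    exact (c.le_opNorm _).trans_eq (congrArg _ (Equiv.prod_comp σ fun i => ‖v i‖))
  refine (norm_sum_le_of_le _ fun σ _ => hterm σ).trans_eq ?_
  rw [Finset.sum_const, Finset.card_univ, Fintype.card_perm, nsmul_eq_mul, mul_assoc]

/-- Alternatization of multilinear maps as a continuous linear map. -/
noncomputable def alternatizationCLM (E F ι : Type*) [NormedAddCommGroup E] [NormedSpace ℝ E]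
    [NormedAddCommGroup F] [NormedSpace ℝ F] [Fintype ι] [DecidableEq ι] :
    ContinuousMultilinearMap ℝ (fun _ : ι => E) F →L[ℝ] E [⋀^ι]→L[ℝ] F :=
  LinearMap.mkContinuous
    { toFun := ContinuousMultilinearMap.alternatization
      map_add' := map_add _
      map_smul' := fun a c => by
        ext v
        simp [ContinuousMultilinearMap.alternatization_apply_apply, Finset.smul_sum,
          smul_comm a] } (Fintype.card ι).factorial norm_alternatization_le

theorem alternatizationCLM_toContinuousMultilinearMap [DecidableEq ι] (c : E [⋀^ι]→L[ℝ] F) :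
    alternatizationCLM E F ι c.toContinuousMultilinearMap =
      ((Fintype.card ι).factorial : ℝ) • c := by
  ext v
  have h := DFunLike.congr_fun (AlternatingMap.coe_alternatization c.toAlternatingMap) v
  rw [← Nat.cast_smul_eq_nsmul ℝ] at h
  refine Eq.trans ?_ h
  rw [MultilinearMap.alternatization_apply]
  exact ContinuousMultilinearMap.alternatization_apply_apply _ _

theorem contDiff_compContinuousLinearMap :
    ContDiff ℝ ∞ fun p : (F [⋀^ι]→L[ℝ] G) × (E →L[ℝ] F) => p.1.compContinuousLinearMap p.2 := by
  classical
  let M := ContinuousMultilinearMap.compContinuousLinearMapContinuousMultilinear ℝ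
    (fun _ : ι => E) (fun _ : ι => F) G
  let T := ContinuousAlternatingMap.toContinuousMultilinearMapCLM (𝕜 := ℝ) (E := F) (F := G)
    (ι := ι) ℝ
  have h : ContDiff ℝ ∞ fun p : (F [⋀^ι]→L[ℝ] G) × (E →L[ℝ] F) => M (fun _ => p.2) (T p.1) :=
    (M.contDiff.comp (contDiff_pi.2 fun _ => contDiff_snd)).clm_apply
      (T.contDiff.comp contDiff_fst)
  have h' : ∀ p : (F [⋀^ι]→L[ℝ] G) × (E →L[ℝ] F), p.1.compContinuousLinearMap p.2 =
      ((Fintype.card ι).factorial : ℝ)⁻¹ •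
        alternatizationCLM E G ι (M (fun _ => p.2) (T p.1)) := fun p => by
    have := alternatizationCLM_toContinuousMultilinearMap (p.1.compContinuousLinearMap p.2)
    exact (eq_inv_smul_iff₀ (Nat.cast_ne_zero.2 (Nat.factorial_ne_zero _))).2 this.symm
  rw [funext h']
  exact ((alternatizationCLM E G ι).contDiff.comp h).const_smul _

end Smoothness

section Forms

variable {ι : Type*}

/-- The pullback `f^*α` of the differential form `α` under `f`. -/
noncomputable def formPullback (f : E → F) (α : F → F [⋀^ι]→L[ℝ] G) (z : E) : E [⋀^ι]→L[ℝ] G :=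
  (α (f z)).compContinuousLinearMap (fderiv ℝ f z)

variable {α β : F → F [⋀^ι]→L[ℝ] G} {f g : E → F} {x : E}

theorem SmoothNear.pullback [Fintype ι] (hα : SmoothNear α (f x)) (hf : SmoothNear f x) :
    SmoothNear (formPullback f α) x :=
  SmoothNear.comp (.of_contDiff contDiff_compContinuousLinearMap)
    (f := fun z => (α (f z), _root_.fderiv ℝ f z))
    ((hα.comp hf).mp (hf.fderiv.mono fun _ h₂ h₁ => h₁.prodMk h₂))

theorem formPullback_congr (hf : ContinuousAt f x) (h : α =ᶠ[𝓝 (f x)] β) :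
    formPullback f α =ᶠ[𝓝 x] formPullback f β := by
  filter_upwards [hf.eventually h] with z hz
  simp only [formPullback, hz]

theorem formPullback_congr_left (h : f =ᶠ[𝓝 x] g) :
    formPullback f α =ᶠ[𝓝 x] formPullback g α := by
  filter_upwards [h.eventuallyEq_nhds] with z hz
  simp only [formPullback, hz.self_of_nhds, hz.fderiv_eq]

theorem formPullback_id : formPullback id α = α := by
  ext z w
  simp [formPullback]

theorem formPullback_comp {h : E → F} {α : G → G [⋀^ι]→L[ℝ] H} {g : F → G}
    (hg : SmoothNear g (h x)) (hh : SmoothNear h x) :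
    formPullback (fun z => g (h z)) α =ᶠ[𝓝 x] formPullback h (formPullback g α) := by
  filter_upwards [hh.eventually_differentiableAt,
    hh.continuousAt.eventually hg.eventually_differentiableAt] with z hz hz'
  have hcomp : fderiv ℝ (fun z => g (h z)) z = (fderiv ℝ g (h z)).comp (fderiv ℝ h z) :=
    (hz'.hasFDerivAt.comp z hz.hasFDerivAt).fderiv
  simp only [formPullback, hcomp]
  rfl

end Forms

section Closed

variable {q : ℕ}

/-- `α` is a smooth closed form in a neighbourhood of `x`. -/
structure ClosedNear (α : E → E [⋀^Fin q]→L[ℝ] F) (x : E) : Prop where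
  smoothNear : SmoothNear α x
  extDeriv_eq_zero : ∀ᶠ z in 𝓝 x, extDeriv α z = 0

theorem ClosedNear.pullback {α : F → F [⋀^Fin q]→L[ℝ] G} {f : E → F} {x : E}
    (hα : ClosedNear α (f x)) (hf : SmoothNear f x) : ClosedNear (formPullback f α) x where
  smoothNear := hα.smoothNear.pullback hf
  extDeriv_eq_zero := by
    filter_upwards [hf, hf.continuousAt.eventually hα.smoothNear.eventually_differentiableAt,
      hf.continuousAt.eventually hα.extDeriv_eq_zero] with z hfz hαz hz
    refine (extDeriv_pullback hαz hfz (by simp; norm_cast)).trans ?_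
    rw [hz]
    rfl

end Closed

section Annihilator

variable {𝕜 : Type*} [NontriviallyNormedField 𝕜] {V W : Type*} [NormedAddCommGroup V]
  [NormedSpace 𝕜 V] [NormedAddCommGroup W] [NormedSpace 𝕜 W] {q : ℕ}
  (c : V [⋀^Fin (q + 1)]→L[𝕜] W)

theorem apply_eq_zero_of_curryLeft_eq_zero {w : Fin (q + 1) → V} {k : Fin (q + 1)}
    (h : c.curryLeft (w k) = 0) : c w = 0 := by
  rw [← Fin.insertNth_self_removeNth k w, c.map_insertNth]
  exact (congrArg _ (DFunLike.congr_fun h (k.removeNth w))).trans (smul_zero _)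

theorem apply_congr_of_curryLeft_sub_eq_zero {w w' : Fin (q + 1) → V}
    (h : ∀ i, c.curryLeft (w i - w' i) = 0) : c w = c w' := by
  suffices key : ∀ s : Finset (Fin (q + 1)), c (s.piecewise w w') = c w' by
    simpa using key Finset.univ
  intro s
  induction s using Finset.induction_on with
  | empty => simp
  | insert a s ha ih =>
    have hupdate : s.piecewise w w' = Function.update (s.piecewise w w') a (w' a) := by
      rw [Function.eq_update_iff]
      simp [ha]
    rw [← ih, Finset.piecewise_insert, ← sub_eq_zero]
    nth_rewrite 2 [hupdate]
    rw [← c.map_update_sub]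
    exact apply_eq_zero_of_curryLeft_eq_zero c (k := a) (by simpa using h a)

theorem comp_id_sub_smulRight {v : V} (hv : c.curryLeft v = 0) (ℓ : V →L[𝕜] 𝕜) :
    c.compContinuousLinearMap (.id 𝕜 V - ℓ.smulRight v) = c := by
  ext w
  refine apply_congr_of_curryLeft_sub_eq_zero c fun i => ?_
  simp [hv]

end Annihilator

section Reduction

variable {q : ℕ}

theorem fderiv_apply_eq_zero_of_extDeriv_eq_zero {α : E → E [⋀^Fin (q + 1)]→L[ℝ] F} {x v : E}
    (hα : DifferentiableAt ℝ α x) (hd : extDeriv α x = 0)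
    (hv : ∀ᶠ z in 𝓝 x, (α z).curryLeft v = 0) : fderiv ℝ α x v = 0 := by
  ext w
  have h := DFunLike.congr_fun hd (Fin.cons v w : Fin (q + 2) → E)
  rw [extDeriv_apply hα, Fin.sum_univ_succ, Finset.sum_eq_zero] at h
  · rw [fderiv_continuousAlternatingMap_apply_const_apply hα] at h
    simpa using h
  · intro i _
    have hzero : (fun y => α y (i.succ.removeNth (Fin.cons v w : Fin (q + 2) → E))) =ᶠ[𝓝 x]
        fun _ => 0 := by
      filter_upwards [hv] with y hy
      exact apply_eq_zero_of_curryLeft_eq_zero _ (k := 0) (by simpa [Fin.removeNth_apply] using hy)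
    rw [hzero.fderiv_eq]
    simp

theorem eventually_eq_hyperplaneProj {f : E → F} {x v : E}
    (hf : ∀ᶠ z in 𝓝 x, DifferentiableAt ℝ f z) (hv : ∀ᶠ z in 𝓝 x, fderiv ℝ f z v = 0)
    (ℓ : E →L[ℝ] ℝ) : ∀ᶠ z in 𝓝 x, f z = f (hyperplaneProj ℓ v x z) := by
  obtain ⟨r, hr, h⟩ := Metric.eventually_nhds_iff_ball.1 (hf.and hv)
  have hproj : Tendsto (hyperplaneProj ℓ v x) (𝓝 x) (𝓝 x) := by
    simpa only [hyperplaneProj_self] using (contDiff_hyperplaneProj ℓ v x).continuous.tendsto x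
  filter_upwards [hproj.eventually (Metric.ball_mem_nhds x hr), Metric.ball_mem_nhds x hr]
    with z hz hz'
  let γ : ℝ → E := AffineMap.lineMap z (hyperplaneProj ℓ v x z)
  have hγ : ∀ t ∈ Set.Icc (0 : ℝ) 1, γ t ∈ Metric.ball x r := fun t ht =>
    (convex_ball x r).segment_subset hz' hz
      (segment_eq_image_lineMap ℝ z _ ▸ Set.mem_image_of_mem _ ht)
  have hderiv : ∀ t ∈ Set.Icc (0 : ℝ) 1, HasDerivAt (fun t => f (γ t)) 0 t := by
    intro t ht
    obtain ⟨hdiff, hzero⟩ := h _ (hγ t ht)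
    refine (hdiff.hasFDerivAt.comp_hasDerivAt t AffineMap.hasDerivAt_lineMap).congr_deriv ?_
    simp [hyperplaneProj, hzero]
  have hconst := constant_of_has_deriv_right_zero
    (fun t ht => (hderiv t ht).continuousAt.continuousWithinAt)
    (fun t ht => (hderiv t ⟨ht.1, ht.2.le⟩).hasDerivWithinAt) 1 (by simp)
  simpa [γ] using hconst.symm

theorem ClosedNear.eventuallyEq_formPullback_hyperplaneProj
    {α : E → E [⋀^Fin (q + 1)]→L[ℝ] F} {x v : E} (hα : ClosedNear α x)
    (hv : ∀ᶠ z in 𝓝 x, (α z).curryLeft v = 0) (ℓ : E →L[ℝ] ℝ) :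
    α =ᶠ[𝓝 x] formPullback (hyperplaneProj ℓ v x) α := by
  have hderiv : ∀ᶠ z in 𝓝 x, fderiv ℝ α z v = 0 := by
    filter_upwards [hα.smoothNear.eventually_differentiableAt, hα.extDeriv_eq_zero,
      eventually_eventually_nhds.2 hv] with z hdiff hclosed hvz
    exact fderiv_apply_eq_zero_of_extDeriv_eq_zero hdiff hclosed hvz
  filter_upwards [hv, eventually_eq_hyperplaneProj hα.smoothNear.eventually_differentiableAt
    hderiv ℓ] with z hvz hz
  rw [formPullback, (hasFDerivAt_hyperplaneProj ℓ v x z).fderiv, ← hz,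
    comp_id_sub_smulRight _ hvz]

theorem exists_hyperplaneProj_eq_add (ℓ : E →L[ℝ] ℝ) {v : E} (hv : ℓ v = 1) (x : E) :
    ∃ p : E →L[ℝ] LinearMap.ker (ℓ : E →ₗ[ℝ] ℝ), Function.Surjective p ∧
      ∀ z, hyperplaneProj ℓ v x z = p z + ℓ x • v := by
  let p : E →L[ℝ] LinearMap.ker (ℓ : E →ₗ[ℝ] ℝ) :=
    (.id ℝ E - ℓ.smulRight v : E →L[ℝ] E).codRestrict _ fun z => by simp [hv]
  have hp : ∀ z, (p z : E) = z - ℓ z • v := fun z => rfl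
  refine ⟨p, fun h => ⟨h, Subtype.ext ?_⟩, fun z => ?_⟩
  · have hh : ℓ h = 0 := h.2
    rw [hp, hh, zero_smul, sub_zero]
  · rw [hp, hyperplaneProj, map_sub]
    module

theorem ClosedNear.exists_eq_formPullback_ker {α : E → E [⋀^Fin (q + 1)]→L[ℝ] F} {x v : E}
    (hα : ClosedNear α x) (hker : ∀ᶠ z in 𝓝 x, (α z).curryLeft v = 0) {ℓ : E →L[ℝ] ℝ}
    (hℓ : ℓ v = 1) :
    ∃ (p : E →L[ℝ] LinearMap.ker (ℓ : E →ₗ[ℝ] ℝ))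
      (β : LinearMap.ker (ℓ : E →ₗ[ℝ] ℝ) →
        LinearMap.ker (ℓ : E →ₗ[ℝ] ℝ) [⋀^Fin (q + 1)]→L[ℝ] F),
      Function.Surjective p ∧ ClosedNear β (p x) ∧ α =ᶠ[𝓝 x] formPullback p β := by
  obtain ⟨p, hsurj, hp⟩ := exists_hyperplaneProj_eq_add ℓ hℓ x
  let a : LinearMap.ker (ℓ : E →ₗ[ℝ] ℝ) → E := fun h => h + ℓ x • v
  have ha : ContDiff ℝ ∞ a := by
    have := (LinearMap.ker (ℓ : E →ₗ[ℝ] ℝ)).subtypeL.contDiff (n := ∞)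
    exact this.add contDiff_const
  have hapx : a (p x) = x := by simp only [a, ← hp, hyperplaneProj_self]
  refine ⟨p, formPullback a α, hsurj, .pullback (hapx.symm ▸ hα) (.of_contDiff ha), ?_⟩
  calc
    α =ᶠ[𝓝 x] formPullback (fun z => a (p z)) α :=
      (funext hp : hyperplaneProj ℓ v x = _) ▸
        hα.eventuallyEq_formPullback_hyperplaneProj hker ℓ
    _ =ᶠ[𝓝 x] formPullback p (formPullback a α) :=
      formPullback_comp (.of_contDiff ha) (.of_contDiff p.contDiff)

theorem ClosedNear.exists_reduction [FiniteDimensional ℝ E] {α : E → E [⋀^Fin (q + 1)]→L[ℝ] F}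
    {x : E} (hα : ClosedNear α x) {X : E → E} (hX : SmoothNear X x) (hXx : X x ≠ 0)
    (hker : ∀ᶠ z in 𝓝 x, (α z).curryLeft (X z) = 0) :
    ∃ (K : Submodule ℝ E) (π : E → K) (β : K → K [⋀^Fin (q + 1)]→L[ℝ] F),
      Module.finrank ℝ K + 1 = Module.finrank ℝ E ∧ SmoothNear π x ∧
      Function.Surjective (fderiv ℝ π x) ∧ ClosedNear β (π x) ∧ α =ᶠ[𝓝 x] formPullback π β := by
  obtain ⟨f, g, hfx, hgx, hf, hg, hgf, hfg, hfX⟩ := hX.exists_straightening hXx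
  have hft : Tendsto f (𝓝 x) (𝓝 x) := by simpa only [hfx] using hf.continuousAt.tendsto
  have hker' : ∀ᶠ z in 𝓝 x, (formPullback f α z).curryLeft (X x) = 0 := by
    filter_upwards [hfX, hft.eventually hker] with z hz hz'
    rw [formPullback, ContinuousAlternatingMap.curryLeft_compContinuousLinearMap, hz, hz']
    rfl
  obtain ⟨ℓ, hℓ⟩ := SeparatingDual.exists_eq_one (R := ℝ) hXx
  obtain ⟨p, β, hsurj, hβ, hαβ⟩ :=
    (ClosedNear.pullback (hfx.symm ▸ hα) hf).exists_eq_formPullback_ker hker' hℓ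
  have hp : SmoothNear p (g x) := .of_contDiff p.contDiff
  refine ⟨_, fun z => p (g z), β, ?_, hp.comp hg, ?_, by simpa only [hgx] using hβ, ?_⟩
  · exact Module.Dual.finrank_ker_add_one_of_ne_zero (f := (ℓ : E →ₗ[ℝ] ℝ)) fun h => by
      simpa [hℓ] using LinearMap.congr_fun h (X x)
  · have hgf' := (eventually_fderiv_comp_eq_id hf (hfx.symm ▸ hg) hgf).self_of_nhds
    rw [hfx] at hgf'
    have hπ : fderiv ℝ (fun z => p (g z)) x = p.comp (fderiv ℝ g x) :=
      (p.hasFDerivAt.comp x hg.differentiableAt.hasFDerivAt).fderiv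
    rw [hπ]
    exact hsurj.comp fun w => ⟨_, DFunLike.congr_fun hgf' w⟩
  · calc
      α = formPullback id α := formPullback_id.symm
      _ =ᶠ[𝓝 x] formPullback (fun z => f (g z)) α :=
        formPullback_congr_left (hfg.mono fun _ hz => hz.symm)
      _ =ᶠ[𝓝 x] formPullback g (formPullback f α) := formPullback_comp (hgx.symm ▸ hf) hg
      _ =ᶠ[𝓝 x] formPullback g (formPullback p β) :=
        formPullback_congr hg.continuousAt (hgx.symm ▸ hαβ)
      _ =ᶠ[𝓝 x] formPullback (fun z => p (g z)) β := (formPullback_comp hp hg).symm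

end Reduction

section Rank

variable {𝕜 : Type*} [NontriviallyNormedField 𝕜] {V W U : Type*} [NormedAddCommGroup V]
  [NormedSpace 𝕜 V] [NormedAddCommGroup W] [NormedSpace 𝕜 W] [NormedAddCommGroup U]
  [NormedSpace 𝕜 U] {q : ℕ}

/-- The rank of an alternating form: the codimension of the space of vectors `v` with
`c (v, ⬝, …, ⬝) = 0`, in finite dimension. -/
noncomputable def formRank (c : V [⋀^Fin (q + 1)]→L[𝕜] U) : ℕ :=
  Module.finrank 𝕜 (LinearMap.range (c.curryLeft : V →ₗ[𝕜] V [⋀^Fin q]→L[𝕜] U))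

theorem compContinuousLinearMap_injective {ι : Type*} {A : V →L[𝕜] W}
    (hA : Function.Surjective A) :
    Function.Injective fun c : W [⋀^ι]→L[𝕜] U => c.compContinuousLinearMap A := by
  intro c d hcd
  ext w
  choose u hu using fun i => hA (w i)
  obtain rfl : A ∘ u = w := funext hu
  exact DFunLike.congr_fun hcd u

theorem formRank_compContinuousLinearMap (c : W [⋀^Fin (q + 1)]→L[𝕜] U) {A : V →L[𝕜] W}
    (hA : Function.Surjective A) : formRank (c.compContinuousLinearMap A) = formRank c := by
  let T : (W [⋀^Fin q]→L[𝕜] U) →ₗ[𝕜] (V [⋀^Fin q]→L[𝕜] U) :=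
    (ContinuousAlternatingMap.compContinuousLinearMapCLM A).toLinearMap
  have hT : Function.Injective T := compContinuousLinearMap_injective hA
  have hcurry : ((c.compContinuousLinearMap A).curryLeft : V →ₗ[𝕜] V [⋀^Fin q]→L[𝕜] U) =
      (T ∘ₗ (c.curryLeft : W →ₗ[𝕜] W [⋀^Fin q]→L[𝕜] U)) ∘ₗ (A : V →ₗ[𝕜] W) := by
    ext u
    simp [T, ContinuousAlternatingMap.curryLeft_compContinuousLinearMap]
  rw [formRank, hcurry, LinearMap.range_comp_of_range_eq_top _ (LinearMap.range_eq_top.2 hA),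
    LinearMap.range_comp]
  exact (Submodule.equivMapOfInjective T hT _).symm.finrank_eq

theorem formRank_eq_zero_iff [FiniteDimensional 𝕜 V] {c : V [⋀^Fin (q + 1)]→L[𝕜] U} :
    formRank c = 0 ↔ c = 0 := by
  rw [formRank, Submodule.finrank_eq_zero, LinearMap.range_eq_bot]
  refine ⟨fun h => ?_, fun h => by subst h; rfl⟩
  ext w
  exact apply_eq_zero_of_curryLeft_eq_zero c (k := 0) (LinearMap.congr_fun h (w 0))

theorem apply_eq_zero_of_finrank_range_le {k V W R : Type*} [DivisionRing k] [AddCommGroup V]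
    [Module k V] [FiniteDimensional k V] [AddCommGroup W] [Module k W] [AddCommGroup R]
    [Module k R] {A : V →ₗ[k] W} {P : W →ₗ[k] R} (hPA : Function.Surjective (P ∘ₗ A))
    (hrank : Module.finrank k (LinearMap.range A) ≤ Module.finrank k R) {v : V}
    (hv : P (A v) = 0) : A v = 0 := by
  have : FiniteDimensional k R := Module.Finite.of_surjective _ hPA
  have hsurj : Function.Surjective (P.domRestrict (LinearMap.range A)) := fun r =>
    (hPA r).imp' (fun u => ⟨A u, u, rfl⟩) fun _ h => h
  have heq := hrank.antisymm (LinearMap.finrank_le_finrank_of_surjective hsurj)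
  have hinj := (LinearMap.injective_iff_surjective_of_finrank_eq_finrank heq).2 hsurj
  exact congrArg Subtype.val (@hinj ⟨A v, v, rfl⟩ 0 (hv.trans (map_zero _).symm))

end Rank

section KernelField

-- With `g` a right inverse of `A x` onto its range and `P` a projection onto that range,
-- `B z = P ∘ A z ∘ g` is invertible near `x`, and the kernel field is obtained from `v` by
-- removing the component `g (B z)⁻¹ P (A z v)`.
theorem SmoothNear.exists_kernel_section [FiniteDimensional ℝ F] {A : E → F →L[ℝ] G} {x : E}
    (hA : SmoothNear A x)
    (hrank : ∀ᶠ z in 𝓝 x, Module.finrank ℝ (LinearMap.range (A z : F →ₗ[ℝ] G)) ≤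
      Module.finrank ℝ (LinearMap.range (A x : F →ₗ[ℝ] G)))
    {v : F} (hv : A x v = 0) :
    ∃ Z : E → F, SmoothNear Z x ∧ Z x = v ∧ ∀ᶠ z in 𝓝 x, A z (Z z) = 0 := by
  let R := LinearMap.range (A x : F →ₗ[ℝ] G)
  have : CompleteSpace R := FiniteDimensional.complete ℝ R
  obtain ⟨g, hg⟩ := ContinuousLinearMap.HasRightInverse.of_surjective_of_finiteDimensional
    (f := (A x).codRestrict R fun u => ⟨u, rfl⟩) fun ⟨_, u, hu⟩ => ⟨u, Subtype.ext hu⟩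
  obtain ⟨P, hP⟩ := Submodule.ClosedComplemented.of_finiteDimensional R
  let B : E → R →L[ℝ] R := fun z => P.comp ((A z).comp g)
  have hB : SmoothNear B x := .clm_comp (.const P) (.clm_comp hA (.const g))
  have hBx : (B x).IsInvertible := by
    have hid : B x = .id ℝ R := by
      ext1 r
      exact (congrArg P (congrArg Subtype.val (hg r))).trans (hP r)
    exact hid ▸ ⟨.refl ℝ R, rfl⟩
  have hAv : SmoothNear (fun z => A z v) x := hA.clm_apply (.const v)
  refine ⟨fun z => v - g ((B z).inverse (P (A z v))), ?_, by simp [hv], ?_⟩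
  · exact (SmoothNear.const v).sub ((SmoothNear.const g).clm_apply
      ((hB.inverse hBx).clm_apply ((SmoothNear.const P).clm_apply hAv)))
  · filter_upwards [eventually_isInvertible hB.continuousAt hBx, hrank] with z hBz hrz
    refine apply_eq_zero_of_finrank_range_le (P := (P : G →ₗ[ℝ] R)) (A := (A z : F →ₗ[ℝ] G))
      (fun r => ?_) hrz ?_
    · exact (hBz.surjective r).imp' g fun _ h => h
    · have hcancel : P (A z (g ((B z).inverse (P (A z v))))) = P (A z v) :=
        hBz.self_apply_inverse _
      simp [hcancel]

theorem SmoothNear.curryLeft {q : ℕ} {α : G → E [⋀^Fin (q + 1)]→L[ℝ] F} {x : G}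
    (hα : SmoothNear α x) : SmoothNear (fun z => (α z).curryLeft) x :=
  SmoothNear.comp (h := fun c : E [⋀^Fin (q + 1)]→L[ℝ] F => c.curryLeft)
    (.of_contDiff (LinearIsometry.contDiff (𝕜 := ℝ) (E := E [⋀^Fin (q + 1)]→L[ℝ] F)
      (F := E →L[ℝ] E [⋀^Fin q]→L[ℝ] F) ContinuousAlternatingMap.curryLeftLI)) hα

theorem SmoothNear.exists_annihilating_vectorField [FiniteDimensional ℝ E] {q : ℕ}
    {α : E → E [⋀^Fin (q + 1)]→L[ℝ] F} {x : E} (hα : SmoothNear α x)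
    (hrank : ∀ᶠ z in 𝓝 x, formRank (α z) = formRank (α x)) {v : E}
    (hv : (α x).curryLeft v = 0) :
    ∃ X : E → E, SmoothNear X x ∧ X x = v ∧ ∀ᶠ z in 𝓝 x, (α z).curryLeft (X z) = 0 :=
  hα.curryLeft.exists_kernel_section (hrank.mono fun _ h => h.le) hv

end KernelField

section Rectifiable

/-- Near `x`, the form `α` is the pullback of a constant form under a local diffeomorphism. -/
def Rectifiable {ι : Type*} (α : E → E [⋀^ι]→L[ℝ] G) (x : E) : Prop :=
  ∃ (Ψ : E → E) (c : E [⋀^ι]→L[ℝ] G), SmoothNear Ψ x ∧ (fderiv ℝ Ψ x).IsInvertible ∧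
    α =ᶠ[𝓝 x] formPullback Ψ fun _ => c

namespace Rectifiable

variable {ι : Type*} {α : E → E [⋀^ι]→L[ℝ] G} {x : E}

theorem of_eventuallyEq_const {c : E [⋀^ι]→L[ℝ] G} (h : α =ᶠ[𝓝 x] fun _ => c) :
    Rectifiable α x := by
  refine ⟨id, c, .of_contDiff contDiff_id, ?_, by rwa [formPullback_id]⟩
  rw [fderiv_id]
  exact ⟨.refl ℝ E, rfl⟩

theorem of_submersion {f : E → F} {c : F [⋀^ι]→L[ℝ] G} (hf : SmoothNear f x)
    (hsub : (fderiv ℝ f x).HasRightInverse) (h : α =ᶠ[𝓝 x] formPullback f fun _ => c) :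
    Rectifiable α x := by
  obtain ⟨S, hS⟩ := hsub
  set D := fderiv ℝ f x with hD
  have hderiv : ∀ᶠ z in 𝓝 x, fderiv ℝ (fun y => y + S (f y - D y)) z =
      .id ℝ E + S.comp (fderiv ℝ f z - D) := by
    filter_upwards [hf.eventually_differentiableAt] with z hz
    exact ((hasFDerivAt_id z).add
      (S.hasFDerivAt.comp z (hz.hasFDerivAt.sub D.hasFDerivAt))).fderiv
  refine ⟨fun y => y + S (f y - D y), c.compContinuousLinearMap D, ?_, ?_, ?_⟩
  · exact (SmoothNear.of_contDiff contDiff_id).add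
      ((SmoothNear.const S).clm_apply (hf.sub (.of_contDiff D.contDiff)))
  · rw [hderiv.self_of_nhds, ← hD, sub_self, ContinuousLinearMap.comp_zero, add_zero]
    exact ⟨.refl ℝ E, rfl⟩
  · filter_upwards [hderiv, h] with z hz hαz
    rw [hαz, formPullback, formPullback, hz]
    ext w
    simp [Function.comp_def, hS _]

theorem of_pullback {f : E → F} {β : F → F [⋀^ι]→L[ℝ] G} (hf : SmoothNear f x)
    (hsub : (fderiv ℝ f x).HasRightInverse) (h : α =ᶠ[𝓝 x] formPullback f β)
    (hβ : Rectifiable β (f x)) : Rectifiable α x := by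
  obtain ⟨Ψ, c, hΨ, hinv, hc⟩ := hβ
  refine .of_submersion (f := fun z => Ψ (f z)) (c := c) (hΨ.comp hf) ?_ ?_
  · have hcomp : fderiv ℝ (fun z => Ψ (f z)) x = (fderiv ℝ Ψ (f x)).comp (fderiv ℝ f x) :=
      (hΨ.differentiableAt.hasFDerivAt.comp x hf.differentiableAt.hasFDerivAt).fderiv
    exact hcomp ▸ (ContinuousLinearMap.HasRightInverse.of_isInvertible hinv).comp hsub
  · calc
      α =ᶠ[𝓝 x] formPullback f β := h
      _ =ᶠ[𝓝 x] formPullback f (formPullback Ψ fun _ => c) :=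
        formPullback_congr hf.continuousAt hc
      _ =ᶠ[𝓝 x] formPullback (fun z => Ψ (f z)) fun _ => c := (formPullback_comp hΨ hf).symm

theorem exists_fderiv_eq_id (h : Rectifiable α x) :
    ∃ Ψ : E → E, SmoothNear Ψ x ∧ fderiv ℝ Ψ x = .id ℝ E ∧
      α =ᶠ[𝓝 x] formPullback Ψ fun _ => α x := by
  obtain ⟨Ψ, c, hΨ, hinv, hc⟩ := h
  set D := fderiv ℝ Ψ x with hD
  have hderiv : ∀ᶠ z in 𝓝 x, fderiv ℝ (fun y => D.inverse (Ψ y)) z =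
      D.inverse.comp (fderiv ℝ Ψ z) := by
    filter_upwards [hΨ.eventually_differentiableAt] with z hz
    exact (D.inverse.hasFDerivAt.comp z hz.hasFDerivAt).fderiv
  refine ⟨fun y => D.inverse (Ψ y), (SmoothNear.const D.inverse).clm_apply hΨ, ?_, ?_⟩
  · rw [hderiv.self_of_nhds, ← hD, hinv.inverse_comp_self]
  · filter_upwards [hderiv, hc] with z hz hz'
    rw [hz', hc.self_of_nhds]
    simp only [formPullback, hz, ← hD]
    ext w
    simp [Function.comp_def, hinv.self_apply_inverse]

end Rectifiable

theorem eventually_hasRightInverse [CompleteSpace F] {X : Type*} [TopologicalSpace X]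
    {A : X → E →L[ℝ] F} {x : X} (hA : ContinuousAt A x) (hx : (A x).HasRightInverse) :
    ∀ᶠ z in 𝓝 x, (A z).HasRightInverse := by
  obtain ⟨S, hS⟩ := hx
  have hinv : ((A x).comp S).IsInvertible :=
    ⟨.refl ℝ F, ContinuousLinearMap.ext fun w => (hS w).symm⟩
  filter_upwards [eventually_isInvertible (hA.clm_comp continuousAt_const) hinv] with z hz
  exact (ContinuousLinearMap.HasRightInverse.of_isInvertible hz).of_comp

theorem ClosedNear.rectifiable_of_kernel [FiniteDimensional ℝ E] {q : ℕ}
    {α : E → E [⋀^Fin (q + 1)]→L[ℝ] G} {x : E} (hα : ClosedNear α x)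
    (hrank : ∀ᶠ z in 𝓝 x, formRank (α z) = formRank (α x)) {v : E} (hv0 : v ≠ 0)
    (hv : (α x).curryLeft v = 0)
    (ih : ∀ (K : Submodule ℝ E) (β : K → K [⋀^Fin (q + 1)]→L[ℝ] G) (y : K),
      Module.finrank ℝ K + 1 = Module.finrank ℝ E → ClosedNear β y →
      (∀ᶠ h in 𝓝 y, formRank (β h) = formRank (α x)) → Rectifiable β y) : Rectifiable α x := by
  have : CompleteSpace E := FiniteDimensional.complete ℝ E
  obtain ⟨X, hX, hXx, hXker⟩ := hα.smoothNear.exists_annihilating_vectorField hrank hv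
  obtain ⟨K, π, β, hK, hπ, hsurj, hβ, hαβ⟩ := hα.exists_reduction hX (hXx ▸ hv0) hXker
  have : CompleteSpace K := FiniteDimensional.complete ℝ K
  have hright := ContinuousLinearMap.HasRightInverse.of_surjective_of_finiteDimensional hsurj
  have hopen : map π (𝓝 x) = 𝓝 (π x) :=
    (hπ.contDiffAt.hasStrictFDerivAt (by simp)).map_nhds_eq_of_surj
      (LinearMap.range_eq_top.2 hsurj)
  refine .of_pullback hπ hright hαβ (ih K β _ hK hβ ?_)
  rw [← hopen, eventually_map]
  filter_upwards [hαβ, hrank, eventually_hasRightInverse hπ.fderiv.continuousAt hright]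
    with z hz hrz hsz
  rw [← hrz, hz, formPullback, formRank_compContinuousLinearMap _ hsz.surjective]

end Rectifiable

section OneForm

/-- A continuous linear map, viewed as an alternating form of degree one. -/
noncomputable abbrev oneForm : (E →L[ℝ] F) ≃ₗᵢ[ℝ] (E [⋀^Fin 1]→L[ℝ] F) :=
  ContinuousAlternatingMap.ofSubsingletonLIE (𝕜 := ℝ) (E := E) (F := F) (0 : Fin 1)

theorem extDeriv_oneForm {a : E → E →L[ℝ] F} {z : E} (ha : DifferentiableAt ℝ a z) (v w : E) :
    extDeriv (fun y => oneForm (a y)) z ![v, w] = fderiv ℝ a z v w - fderiv ℝ a z w v := by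
  have hcoeff : ∀ v w : E, fderiv ℝ (fun y => a y w) z v = fderiv ℝ a z v w := fun v w => by
    simp [fderiv_clm_apply ha (differentiableAt_const w)]
  have hdiff : DifferentiableAt ℝ (fun y => oneForm (a y)) z :=
    (oneForm (E := E) (F := F)).toContinuousLinearEquiv.differentiableAt.comp z ha
  refine (extDeriv_apply hdiff _).trans ((Fin.sum_univ_two _).trans ?_)
  simp only [Fin.val_zero, Fin.val_one, pow_zero, pow_one, one_smul, neg_one_smul, ← sub_eq_add_neg]
  exact congrArg₂ (· - ·) (hcoeff v w) (hcoeff w v)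

theorem ClosedNear.exists_primitive [CompleteSpace F] {α : E → E [⋀^Fin 1]→L[ℝ] F} {x : E}
    (hα : ClosedNear α x) :
    ∃ u : E → F, SmoothNear u x ∧ ∀ᶠ z in 𝓝 x, α z = oneForm (fderiv ℝ u z) := by
  obtain ⟨r, hr, hball⟩ :=
    Metric.eventually_nhds_iff_ball.1 (hα.smoothNear.and hα.extDeriv_eq_zero)
  let a : E → E →L[ℝ] F := fun z => oneForm.symm (α z)
  have hαa : α = fun z => oneForm (a z) := funext fun z => (oneForm.apply_symm_apply (α z)).symm
  have ha : ∀ z ∈ Metric.ball x r, ContDiffAt ℝ ∞ a z := fun z hz =>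
    (oneForm (E := E) (F := F)).symm.contDiff.contDiffAt.comp z (hball z hz).1
  have hda : ∀ z ∈ Metric.ball x r, DifferentiableAt ℝ a z := fun z hz =>
    (ha z hz).differentiableAt (by simp)
  have hsymm : ∀ z ∈ Metric.ball x r, ∀ v w, fderiv ℝ a z v w = fderiv ℝ a z w v :=
    fun z hz v w => sub_eq_zero.1 <| by
      rw [← extDeriv_oneForm (hda z hz), ← hαa, (hball z hz).2]
      rfl
  obtain ⟨u, hu⟩ := (convex_ball x r).exists_forall_hasFDerivAt_of_fderiv_symmetric
    Metric.isOpen_ball (fun z hz => (hda z hz).differentiableWithinAt) hsymm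
  have hu_smooth : ContDiffOn ℝ ∞ u (Metric.ball x r) :=
    (contDiffOn_infty_iff_fderiv_of_isOpen Metric.isOpen_ball).2
      ⟨fun z hz => (hu z hz).differentiableAt.differentiableWithinAt,
        ContDiffOn.congr (fun z hz => (ha z hz).contDiffWithinAt) fun z hz => (hu z hz).fderiv⟩
  have hmem : ∀ᶠ z in 𝓝 x, z ∈ Metric.ball x r := Metric.ball_mem_nhds x hr
  refine ⟨u, ?_, ?_⟩
  · exact hmem.mono fun z hz => hu_smooth.contDiffAt (Metric.isOpen_ball.mem_nhds hz)
  · filter_upwards [hmem] with z hz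
    rw [(hu z hz).fderiv, hαa]

theorem hasRightInverse_of_ne_zero {ℓ : E →L[ℝ] ℝ} (hℓ : ℓ ≠ 0) : ℓ.HasRightInverse :=
  .of_surjective_of_finiteDimensional <| LinearMap.surjective (f := (ℓ : E →ₗ[ℝ] ℝ)) fun h =>
    hℓ (ContinuousLinearMap.coe_injective h)

theorem ClosedNear.rectifiable_of_one_form {α : E → E [⋀^Fin 1]→L[ℝ] ℝ} {x : E}
    (hα : ClosedNear α x) (hx : α x ≠ 0) : Rectifiable α x := by
  obtain ⟨u, hu, hαu⟩ := hα.exists_primitive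
  have hu0 : fderiv ℝ u x ≠ 0 := fun h => hx (by rw [hαu.self_of_nhds, h, map_zero])
  exact .of_submersion (c := oneForm (.id ℝ ℝ)) hu (hasRightInverse_of_ne_zero hu0) hαu

end OneForm

section TopForm

section LinearAlgebra

variable {𝕜 : Type*} [NontriviallyNormedField 𝕜] {V : Type*} [NormedAddCommGroup V]
  [NormedSpace 𝕜 V] {q : ℕ}

theorem eq_of_apply_basis_eq {ι : Type*} [Finite ι] (b : Module.Basis ι 𝕜 V)
    {c d : V [⋀^ι]→L[𝕜] 𝕜} (h : c b = d b) : c = d := by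
  classical
  have := Fintype.ofFinite ι
  apply ContinuousAlternatingMap.toAlternatingMap_injective
  rw [c.toAlternatingMap.eq_smul_basis_det b, d.toAlternatingMap.eq_smul_basis_det b]
  exact congrArg (· • b.det) h

theorem compContinuousLinearMap_eq_det_smul {ι : Type*} [Finite ι] (b : Module.Basis ι 𝕜 V)
    (c : V [⋀^ι]→L[𝕜] 𝕜) (A : V →L[𝕜] V) : c.compContinuousLinearMap A = A.det • c := by
  classical
  have := Fintype.ofFinite ι
  refine eq_of_apply_basis_eq b ?_
  have hdet := congrArg (fun d : V [⋀^ι]→ₗ[𝕜] 𝕜 => d (A ∘ b))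
    (c.toAlternatingMap.eq_smul_basis_det b)
  refine hdet.trans ?_
  change c b * b.det ((A : V →ₗ[𝕜] V) ∘ b) = A.det * c b
  rw [b.det_comp, b.det_self, mul_one, mul_comm]

theorem det_id_add_smulRight [FiniteDimensional 𝕜 V] (ℓ : V →L[𝕜] 𝕜) (v : V) :
    (.id 𝕜 V + ℓ.smulRight v : V →L[𝕜] V).det = 1 + ℓ v :=
  LinearMap.transvection.det (ℓ : V →ₗ[𝕜] 𝕜) v

theorem isInvertible_of_det_ne_zero [CompleteSpace 𝕜] [FiniteDimensional 𝕜 V] {A : V →L[𝕜] V}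
    (hA : A.det ≠ 0) : A.IsInvertible :=
  ⟨((A : V →ₗ[𝕜] V).equivOfDetNeZero hA).toContinuousLinearEquiv, rfl⟩

end LinearAlgebra

theorem SmoothNear.exists_fderiv_apply_eq [FiniteDimensional ℝ E] {f : E → ℝ} {x : E}
    (hf : SmoothNear f x) (hx : f x ≠ 0) {v : E} (hv : v ≠ 0) :
    ∃ u : E → ℝ, SmoothNear u x ∧ ∀ᶠ z in 𝓝 x, _root_.fderiv ℝ u z v = f z := by
  have hf0 : ∀ᶠ z in 𝓝 x, f z ≠ 0 := hf.continuousAt.eventually_ne hx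
  obtain ⟨u, hu, hXu⟩ := SmoothNear.exists_time_function (X := fun z => (f z)⁻¹ • v) (x := x)
    (by filter_upwards [hf, hf0] with z hz hz0 using (hz.inv hz0).smul contDiffAt_const)
    (smul_ne_zero (inv_ne_zero hx) hv)
  refine ⟨u, hu, ?_⟩
  filter_upwards [hXu, hf0] with z hz hz0
  rwa [map_smul, smul_eq_mul, inv_mul_eq_one₀ hz0, eq_comm] at hz

theorem SmoothNear.exists_eq_smul_of_basis {ι : Type*} [Fintype ι] (b : Module.Basis ι ℝ E)
    {α : E → E [⋀^ι]→L[ℝ] ℝ} {x : E} (hα : SmoothNear α x) (hx : α x ≠ 0) :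
    ∃ f : E → ℝ, SmoothNear f x ∧ f x = 1 ∧ ∀ z, α z = f z • α x := by
  have hb : α x b ≠ 0 := fun h => hx (eq_of_apply_basis_eq b h)
  refine ⟨fun z => α z b / α x b, ?_, div_self hb, fun z => eq_of_apply_basis_eq b ?_⟩
  · have hev := (ContinuousAlternatingMap.apply ℝ E ℝ (b : ι → E)).contDiff (n := ∞)
    exact (SmoothNear.comp (.of_contDiff hev) hα).mono fun z hz => hz.div_const _
  · simp [hb]

-- Since `α z = f z • α x` and `id + ℓ ⊗ v` has determinant `1 + ℓ v`, it suffices to find a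
-- function `u` with `∂u/∂v = f` and to replace the `v`-coordinate of the identity by `u`.
theorem Rectifiable.of_top_form [FiniteDimensional ℝ E] {q : ℕ}
    {α : E → E [⋀^Fin (q + 1)]→L[ℝ] ℝ} {x : E} (hα : SmoothNear α x) (hx : α x ≠ 0)
    (hE : Module.finrank ℝ E = q + 1) : Rectifiable α x := by
  let b : Module.Basis (Fin (q + 1)) ℝ E := Module.finBasisOfFinrankEq ℝ E hE
  obtain ⟨f, hf, hfx, hαf⟩ := hα.exists_eq_smul_of_basis b hx
  obtain ⟨v, hv⟩ : ∃ v : E, v ≠ 0 := ⟨b 0, b.ne_zero 0⟩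
  obtain ⟨u, hu, huv⟩ := hf.exists_fderiv_apply_eq (hfx ▸ one_ne_zero) hv
  obtain ⟨ℓ, hℓ⟩ := SeparatingDual.exists_eq_one (R := ℝ) hv
  let Ψ : E → E := fun y => y + (u y - ℓ y) • v
  have hΨ : ∀ᶠ z in 𝓝 x, fderiv ℝ Ψ z = .id ℝ E + (fderiv ℝ u z - ℓ).smulRight v := by
    filter_upwards [hu.eventually_differentiableAt] with z hz
    exact ((hasFDerivAt_id z).add ((hz.hasFDerivAt.sub ℓ.hasFDerivAt).smul_const v)).fderiv
  have hdet : ∀ᶠ z in 𝓝 x, (fderiv ℝ Ψ z).det = f z := by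
    filter_upwards [hΨ, huv] with z hz hz'
    rw [hz, det_id_add_smulRight, sub_apply, hz', hℓ, add_sub_cancel]
  refine ⟨Ψ, α x, ?_, isInvertible_of_det_ne_zero ?_, ?_⟩
  · exact (SmoothNear.of_contDiff contDiff_id).add ((hu.sub (.of_contDiff ℓ.contDiff)).mono
      fun z hz => hz.smul contDiffAt_const)
  · rw [hdet.self_of_nhds, hfx]
    exact one_ne_zero
  · filter_upwards [hdet] with z hz
    rw [formPullback, compContinuousLinearMap_eq_det_smul b, hz, hαf z]

end TopForm

section CodegreeOne

section LinearAlgebra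

variable {𝕜 : Type*} [NontriviallyNormedField 𝕜] {V U : Type*} [NormedAddCommGroup V]
  [NormedSpace 𝕜 V] [NormedAddCommGroup U] [NormedSpace 𝕜 U] {q : ℕ}

theorem apply_comp_eq_zero {ι : Type*} [Finite ι] (c : V [⋀^ι]→L[𝕜] U) {g : ι → V} (hg : c g = 0)
    (ρ : ι → ι) : c (g ∘ ρ) = 0 := by
  classical
  have := Fintype.ofFinite ι
  by_cases hρ : Function.Injective ρ
  · have hperm := c.toAlternatingMap.map_perm g
      (Equiv.ofBijective ρ (Finite.injective_iff_bijective.1 hρ))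
    exact hperm.trans ((congrArg _ hg).trans (smul_zero _))
  · exact c.toAlternatingMap.map_eq_zero_of_not_injective _ fun h => hρ h.of_comp

theorem exists_notMem_span_update_eq_zero [FiniteDimensional 𝕜 V] {ι : Type*} [Fintype ι]
    [DecidableEq ι] (c : V [⋀^ι]→L[𝕜] 𝕜) {e : ι → V} (he : c e ≠ 0)
    (hdim : Fintype.card ι < Module.finrank 𝕜 V) :
    ∃ v ∉ Submodule.span 𝕜 (Set.range e), ∀ i, c (Function.update e i v) = 0 := by
  let φ : V →ₗ[𝕜] ι → 𝕜 := LinearMap.pi fun i => c.toMultilinearMap.toLinearMap e i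
  have hφ : ∀ a : ι → 𝕜, φ (∑ j, a j • e j) = c e • a := by
    have hφe : ∀ j, φ (e j) = c e • Pi.single j 1 := by
      intro j
      ext i
      obtain rfl | hij := eq_or_ne i j
      · simp [φ]
      · have hzero : c (Function.update e i (e j)) = 0 :=
          c.map_eq_zero_of_eq _ (i := i) (j := j) (by simp [hij.symm]) hij
        simpa [φ, hij] using hzero
    intro a
    simp_rw [map_sum, map_smul, hφe, smul_comm _ (c e), ← Finset.smul_sum]
    exact congrArg _ (pi_eq_sum_univ' a).symm
  obtain ⟨v, hv, hv0⟩ := (Submodule.ne_bot_iff _).1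
    (LinearMap.ker_ne_bot_of_finrank_lt (f := φ) (by simpa using hdim))
  refine ⟨v, fun hspan => hv0 ?_, fun i => congrFun hv i⟩
  obtain ⟨a, rfl⟩ := (Submodule.mem_span_range_iff_exists_fun 𝕜).1 hspan
  have ha : a = 0 := (smul_eq_zero_iff_right he).1 ((hφ a).symm.trans hv)
  simp [ha]

theorem curryLeft_eq_zero_of_update_eq_zero (c : V [⋀^Fin (q + 1)]→L[𝕜] U) {e : Fin (q + 1) → V}
    {v : V} (b : Module.Basis (Fin (q + 2)) 𝕜 V) (hb : ⇑b = Fin.cons v e)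
    (hc : ∀ i, c (Function.update e i v) = 0) : c.curryLeft v = 0 := by
  apply ContinuousAlternatingMap.toAlternatingMap_injective
  refine Module.Basis.ext_alternating b fun σ _ => ?_
  change c (Fin.cons v fun k => b (σ k)) = 0
  by_cases h0 : ∃ k, σ k = 0
  · obtain ⟨k, hk⟩ := h0
    exact c.map_eq_zero_of_eq _ (i := 0) (j := k.succ) (by simp [hk, hb]) (Fin.succ_ne_zero k).symm
  · push Not at h0
    let τ : Fin q → Fin (q + 1) := fun k => (σ k).pred (h0 k)
    obtain ⟨i, hi⟩ : ∃ i, ∀ k, τ k ≠ i := by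
      by_contra! hsurj
      simpa using Fintype.card_le_of_surjective τ hsurj
    have hcons : (Fin.cons v fun k => b (σ k)) = Function.update e i v ∘ Fin.cons i τ := by
      ext k
      refine Fin.cases (by simp) (fun k => ?_) k
      have hbσ : b (σ k) = e (τ k) := by rw [hb, ← Fin.succ_pred (σ k) (h0 k), Fin.cons_succ]
      simp [hbσ, hi k]
    exact hcons ▸ apply_comp_eq_zero c (hc i) _

theorem exists_curryLeft_eq_zero [FiniteDimensional 𝕜 V] (c : V [⋀^Fin (q + 1)]→L[𝕜] 𝕜)
    (hV : Module.finrank 𝕜 V = q + 2) : ∃ v, v ≠ 0 ∧ c.curryLeft v = 0 := by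
  by_cases hc : c = 0
  · have : Nontrivial V := Module.nontrivial_of_finrank_pos (R := 𝕜) (by omega)
    obtain ⟨v, hv⟩ := exists_ne (0 : V)
    exact ⟨v, hv, hc ▸ rfl⟩
  obtain ⟨e, he⟩ := DFunLike.exists_ne hc
  have hindep : LinearIndependent 𝕜 e := by
    by_contra h
    exact he (c.toAlternatingMap.map_linearDependent e h)
  obtain ⟨v, hv, hcv⟩ := exists_notMem_span_update_eq_zero c he (by simp [hV])
  let b := basisOfLinearIndependentOfCardEqFinrank (linearIndependent_finCons.2 ⟨hindep, hv⟩)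
    (by simp [hV])
  refine ⟨v, fun h => hv (h ▸ Submodule.zero_mem _), ?_⟩
  exact curryLeft_eq_zero_of_update_eq_zero c b (by simp [b]) hcv

end LinearAlgebra

theorem ClosedNear.rectifiable_of_codegree_one [FiniteDimensional ℝ E] {q : ℕ}
    {α : E → E [⋀^Fin (q + 1)]→L[ℝ] ℝ} {x : E} (hα : ClosedNear α x)
    (hrank : ∀ᶠ z in 𝓝 x, formRank (α z) = formRank (α x)) (hx : α x ≠ 0)
    (hE : Module.finrank ℝ E = q + 2) : Rectifiable α x := by
  obtain ⟨v, hv0, hv⟩ := exists_curryLeft_eq_zero (α x) hE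
  refine hα.rectifiable_of_kernel hrank hv0 hv fun K β y hK hβ hβr => ?_
  refine Rectifiable.of_top_form hβ.smoothNear ?_ (by omega)
  rw [Ne, ← formRank_eq_zero_iff] at hx ⊢
  rwa [hβr.self_of_nhds]

end CodegreeOne

section Wedge

/-- The wedge product `a ∧ b` of two linear forms. -/
noncomputable def wedge (a b : E →L[ℝ] ℝ) : E [⋀^Fin 2]→L[ℝ] ℝ :=
  ContinuousAlternatingMap.alternatizeUncurryFin (a.smulRight (oneForm b))

theorem wedge_apply (a b : E →L[ℝ] ℝ) (w : Fin 2 → E) :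
    wedge a b w = a (w 0) * b (w 1) - a (w 1) * b (w 0) := by
  rw [wedge, ContinuousAlternatingMap.alternatizeUncurryFin_apply]
  refine (Fin.sum_univ_two _).trans ?_
  simp only [Fin.val_zero, Fin.val_one, pow_zero, pow_one, one_smul, neg_one_smul,
    ← sub_eq_add_neg]
  rfl

theorem extDeriv_smul_oneForm {u : E → ℝ} {z : E} (hu : DifferentiableAt ℝ u z) (b : E →L[ℝ] ℝ) :
    extDeriv (fun y => u y • oneForm b) z = wedge (fderiv ℝ u z) b := by
  have hderiv : fderiv ℝ (fun y => u y • oneForm b) z = (fderiv ℝ u z).smulRight (oneForm b) :=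
    (hu.hasFDerivAt.smul_const (oneForm b)).fderiv
  rw [extDeriv, hderiv, wedge]

theorem curryLeft_wedge (a b : E →L[ℝ] ℝ) (v : E) :
    (wedge a b).curryLeft v = oneForm (a v • b - b v • a) := by
  ext w
  refine (wedge_apply a b _).trans ?_
  change a v * b (w 0) - a (w 0) * b v = a v * b (w 0) - b v * a (w 0)
  rw [mul_comm (a (w 0))]

theorem curryLeft_apply_swap (c : E [⋀^Fin 2]→L[ℝ] ℝ) (v w : E) :
    c.curryLeft v (fun _ => w) = -c.curryLeft w fun _ => v := by
  have hpair : ∀ v w : E, c.curryLeft v (fun _ => w) = c ![v, w] := fun v w =>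
    congrArg c (by ext i; fin_cases i <;> rfl)
  have hswap : (![w, v] : Fin 2 → E) ∘ Equiv.swap 0 1 = ![v, w] := by
    ext i
    fin_cases i <;> simp
  rw [hpair, hpair, ← hswap]
  exact c.toAlternatingMap.map_swap ![w, v] (by simp)

end Wedge

section HyperbolicPlane

/-- The linear forms `a`, `b` restrict to the basis dual to `X`, `Y` on the plane spanned by
`X` and `Y`. -/
structure IsDualPair (a b : E →L[ℝ] ℝ) (X Y : E) : Prop where
  fst_fst : a X = 1
  fst_snd : a Y = 0
  snd_fst : b X = 0
  snd_snd : b Y = 1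

theorem IsDualPair.linearIndependent {a b : E →L[ℝ] ℝ} {X Y : E} (h : IsDualPair a b X Y) :
    LinearIndependent ℝ ![X, Y] := by
  refine LinearIndependent.pair_iff.2 fun s t hst => ⟨?_, ?_⟩
  · simpa [h.fst_fst, h.fst_snd] using congrArg a hst
  · simpa [h.snd_fst, h.snd_snd] using congrArg b hst

theorem IsDualPair.add_wedge_compContinuousLinearMap {a b : F →L[ℝ] ℝ} {X Y : F}
    (h : IsDualPair a b X Y) {c : F [⋀^Fin 2]→L[ℝ] ℝ} (hX : c.curryLeft X = 0)
    (hY : c.curryLeft Y = 0) (A : E →L[ℝ] F) (p r : E →L[ℝ] ℝ) :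
    (c + wedge a b).compContinuousLinearMap
        (A + (p - a.comp A).smulRight X + (r - b.comp A).smulRight Y) =
      c.compContinuousLinearMap A + wedge p r := by
  set D := A + (p - a.comp A).smulRight X + (r - b.comp A).smulRight Y with hD
  have ha : ∀ w, a (D w) = p w := fun w => by simp [hD, h.fst_fst, h.fst_snd]
  have hb : ∀ w, b (D w) = r w := fun w => by simp [hD, h.snd_fst, h.snd_snd]
  have hc : c.compContinuousLinearMap D = c.compContinuousLinearMap A := by
    ext w
    refine apply_congr_of_curryLeft_sub_eq_zero c fun i => ?_
    have hsub : D (w i) - A (w i) = (p - a.comp A) (w i) • X + (r - b.comp A) (w i) • Y := by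
      simp only [hD, add_apply, ContinuousLinearMap.smulRight_apply, add_assoc, add_sub_cancel_left]
    change c.curryLeft (D (w i) - A (w i)) = 0
    rw [hsub, map_add, map_smul, map_smul, hX, hY, smul_zero, smul_zero, add_zero]
  rw [← hc]
  ext w
  simp [wedge_apply, ha, hb]

theorem isInvertible_curryLeft [FiniteDimensional ℝ E] {c : E [⋀^Fin 2]→L[ℝ] ℝ}
    (hc : ∀ v, c.curryLeft v = 0 → v = 0) :
    c.curryLeft.IsInvertible := by
  have : FiniteDimensional ℝ (E [⋀^Fin 1]→L[ℝ] ℝ) :=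
    (oneForm (E := E) (F := ℝ)).toLinearEquiv.finiteDimensional
  have hdim : Module.finrank ℝ E = Module.finrank ℝ (E [⋀^Fin 1]→L[ℝ] ℝ) := by
    rw [← (oneForm (E := E) (F := ℝ)).toLinearEquiv.finrank_eq,
      (LinearMap.toContinuousLinearMap (𝕜 := ℝ) (E := E) (F' := ℝ)).symm.finrank_eq]
    exact (Subspace.dual_finrank_eq (K := ℝ) (V := E)).symm
  have hinj : Function.Injective (c.curryLeft : E →ₗ[ℝ] E [⋀^Fin 1]→L[ℝ] ℝ) :=
    (injective_iff_map_eq_zero _).2 hc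
  exact ⟨(LinearEquiv.ofBijective _ ⟨hinj, (LinearMap.injective_iff_surjective_of_finrank_eq_finrank
    hdim).1 hinj⟩).toContinuousLinearEquiv, rfl⟩

variable {c : E [⋀^Fin 2]→L[ℝ] ℝ} {a b : E →L[ℝ] ℝ} {X Y : E}

theorem curryLeft_sub_wedge (hX : c.curryLeft X = oneForm b) (hY : c.curryLeft Y = -oneForm a)
    (w : E) :
    (c - wedge a b).curryLeft w = c.curryLeft (w - (a w • X + b w • Y)) := by
  change c.curryLeft w - (wedge a b).curryLeft w = _
  rw [curryLeft_wedge, map_sub, map_sub, map_add, map_smul, map_smul, map_smul, map_smul, hX, hY,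
    smul_neg, ← sub_eq_add_neg]

theorem exists_isDualPair (hc : c.curryLeft.IsInvertible) (hX : c.curryLeft X = oneForm b)
    (ha : a X = 1) : ∃ Y, c.curryLeft Y = -oneForm a ∧ IsDualPair a b X Y := by
  obtain ⟨Y, hY⟩ := hc.surjective (-oneForm a)
  have hb : ∀ w, b w = c.curryLeft X fun _ => w := fun w => by rw [hX]; rfl
  have haY : ∀ w, a w = -c.curryLeft Y fun _ => w := fun w => by rw [hY]; exact (neg_neg _).symm
  refine ⟨Y, hY, ha, ?_, ?_, ?_⟩
  · linarith [haY Y, curryLeft_apply_swap c Y Y]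
  · linarith [hb X, curryLeft_apply_swap c X X]
  · rw [hb, curryLeft_apply_swap, ← haY, ha]

theorem IsDualPair.curryLeft_sub_wedge_fst (h : IsDualPair a b X Y)
    (hX : c.curryLeft X = oneForm b) (hY : c.curryLeft Y = -oneForm a) :
    (c - wedge a b).curryLeft X = 0 := by
  rw [curryLeft_sub_wedge hX hY, h.fst_fst, h.snd_fst, one_smul, zero_smul, add_zero, sub_self,
    map_zero]

theorem IsDualPair.curryLeft_sub_wedge_snd (h : IsDualPair a b X Y)
    (hX : c.curryLeft X = oneForm b) (hY : c.curryLeft Y = -oneForm a) :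
    (c - wedge a b).curryLeft Y = 0 := by
  rw [curryLeft_sub_wedge hX hY, h.fst_snd, h.snd_snd, one_smul, zero_smul, zero_add, sub_self,
    map_zero]

theorem IsDualPair.formRank_sub_wedge [FiniteDimensional ℝ E] (h : IsDualPair a b X Y)
    (hc : c.curryLeft.IsInvertible) (hX : c.curryLeft X = oneForm b)
    (hY : c.curryLeft Y = -oneForm a) : formRank (c - wedge a b) + 2 = Module.finrank ℝ E := by
  have hker : LinearMap.ker ((c - wedge a b).curryLeft : E →ₗ[ℝ] E [⋀^Fin 1]→L[ℝ] ℝ) =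
      Submodule.span ℝ {X, Y} := by
    ext w
    rw [Submodule.mem_span_pair]
    constructor
    · intro hw
      have hzero : c.curryLeft (w - (a w • X + b w • Y)) = 0 :=
        (curryLeft_sub_wedge hX hY w).symm.trans hw
      exact ⟨a w, b w, (sub_eq_zero.1 (hc.injective (hzero.trans (map_zero _).symm))).symm⟩
    · rintro ⟨s, t, rfl⟩
      change (c - wedge a b).curryLeft (s • X + t • Y) = 0
      rw [map_add, map_smul, map_smul, h.curryLeft_sub_wedge_fst hX hY,
        h.curryLeft_sub_wedge_snd hX hY, smul_zero, smul_zero, add_zero]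
  have hspan : Module.finrank ℝ (Submodule.span ℝ {X, Y}) = 2 := by
    rw [← Matrix.range_cons_cons_empty X Y ![], finrank_span_eq_card h.linearIndependent,
      Fintype.card_fin]
  rw [← LinearMap.finrank_range_add_finrank_ker
    ((c - wedge a b).curryLeft : E →ₗ[ℝ] E [⋀^Fin 1]→L[ℝ] ℝ), hker, hspan]
  rfl

end HyperbolicPlane

section Darboux

theorem ClosedNear.congr {q : ℕ} {α β : E → E [⋀^Fin q]→L[ℝ] F} {x : E} (hβ : ClosedNear β x)
    (h : α =ᶠ[𝓝 x] β) : ClosedNear α x where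
  smoothNear := hβ.smoothNear.congr h
  extDeriv_eq_zero := by
    filter_upwards [hβ.extDeriv_eq_zero, h.eventuallyEq_nhds] with z hz hαβ
    rw [hαβ.extDeriv_eq, hz]

theorem ClosedNear.sub {q : ℕ} {α β : E → E [⋀^Fin q]→L[ℝ] F} {x : E} (hα : ClosedNear α x)
    (hβ : ClosedNear β x) : ClosedNear (fun z => α z - β z) x where
  smoothNear := hα.smoothNear.sub hβ.smoothNear
  extDeriv_eq_zero := by
    filter_upwards [hα.extDeriv_eq_zero, hβ.extDeriv_eq_zero,
      hα.smoothNear.eventually_differentiableAt, hβ.smoothNear.eventually_differentiableAt]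
      with z hαz hβz hαd hβd
    have hsub : extDeriv (fun y => α y - β y) z = extDeriv α z - extDeriv β z := by
      rw [extDeriv, fderiv_fun_sub hαd hβd]
      exact (ContinuousAlternatingMap.alternatizeUncurryFinCLM ℝ E F).map_sub _ _
    rw [hsub, hαz, hβz, sub_self]

theorem SmoothNear.closedNear_extDeriv {q : ℕ} {η : E → E [⋀^Fin q]→L[ℝ] F} {x : E}
    (hη : SmoothNear η x) : ClosedNear (extDeriv η) x where
  smoothNear := SmoothNear.comp (h := ContinuousAlternatingMap.alternatizeUncurryFinCLM ℝ E F)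
    (.of_contDiff (ContinuousLinearMap.contDiff _)) hη.fderiv
  extDeriv_eq_zero := hη.mono fun _ hz => extDeriv_extDeriv_apply hz (by simp; norm_cast)

theorem SmoothNear.closedNear_wedge_fderiv {u : E → ℝ} {x : E} (hu : SmoothNear u x)
    (b : E →L[ℝ] ℝ) : ClosedNear (fun z => wedge (_root_.fderiv ℝ u z) b) x := by
  have hub : SmoothNear (fun z => u z • oneForm b) x := hu.mono fun _ hz => hz.smul contDiffAt_const
  refine (SmoothNear.closedNear_extDeriv hub).congr ?_
  filter_upwards [hu.eventually_differentiableAt] with z hz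
  exact (extDeriv_smul_oneForm hz b).symm

theorem Rectifiable.add_wedge_fderiv {β : E → E [⋀^Fin 2]→L[ℝ] ℝ} {x : E} (hβ : Rectifiable β x)
    {u : E → ℝ} (hu : SmoothNear u x) {b : E →L[ℝ] ℝ} {X Y : E}
    (h : IsDualPair (fderiv ℝ u x) b X Y) (hX : (β x).curryLeft X = 0)
    (hY : (β x).curryLeft Y = 0) : Rectifiable (fun z => β z + wedge (fderiv ℝ u z) b) x := by
  obtain ⟨Ψ, hΨ, hΨx, hβΨ⟩ := hβ.exists_fderiv_eq_id
  set a := fderiv ℝ u x with ha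
  let Φ : E → E := fun y => Ψ y + (u y - a (Ψ y)) • X + (b y - b (Ψ y)) • Y
  have hΦ : SmoothNear Φ x := by
    filter_upwards [hΨ, hu] with z hΨz huz
    fun_prop
  have hderiv : ∀ᶠ z in 𝓝 x, fderiv ℝ Φ z =
      fderiv ℝ Ψ z + (fderiv ℝ u z - a.comp (fderiv ℝ Ψ z)).smulRight X +
        (b - b.comp (fderiv ℝ Ψ z)).smulRight Y := by
    filter_upwards [hΨ.eventually_differentiableAt, hu.eventually_differentiableAt] with z hΨz huz
    exact ((hΨz.hasFDerivAt.add
      ((huz.hasFDerivAt.sub (a.hasFDerivAt.comp z hΨz.hasFDerivAt)).smul_const X)).add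
      ((b.hasFDerivAt.sub (b.hasFDerivAt.comp z hΨz.hasFDerivAt)).smul_const Y)).fderiv
  refine ⟨Φ, β x + wedge a b, hΦ, ?_, ?_⟩
  · rw [hderiv.self_of_nhds, hΨx, ← ha, ContinuousLinearMap.comp_id, ContinuousLinearMap.comp_id,
      sub_self, sub_self, ContinuousLinearMap.zero_smulRight, ContinuousLinearMap.zero_smulRight,
      add_zero, add_zero]
    exact ⟨.refl ℝ E, rfl⟩
  · filter_upwards [hderiv, hβΨ] with z hz hβz
    rw [formPullback, hz, h.add_wedge_compContinuousLinearMap hX hY, hβz, formPullback]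

/-- If `i_X α = b` is constant and `du(X) = 1`, the kernel of the closed form `α - du ∧ b` is a
plane containing `X`, so that this form is again degenerate of constant rank. -/
theorem SmoothNear.exists_hyperbolic_splitting [FiniteDimensional ℝ E] [Nontrivial E]
    {α : E → E [⋀^Fin 2]→L[ℝ] ℝ} {x : E} (hα : SmoothNear α x)
    (hx : (α x).curryLeft.IsInvertible) :
    ∃ (u : E → ℝ) (b : E →L[ℝ] ℝ) (X Y : E), SmoothNear u x ∧
      IsDualPair (_root_.fderiv ℝ u x) b X Y ∧
      (α x - wedge (_root_.fderiv ℝ u x) b).curryLeft X = 0 ∧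
      (α x - wedge (_root_.fderiv ℝ u x) b).curryLeft Y = 0 ∧
      ∀ᶠ z in 𝓝 x, formRank (α z - wedge (_root_.fderiv ℝ u z) b) + 2 = Module.finrank ℝ E := by
  have : CompleteSpace E := FiniteDimensional.complete ℝ E
  have : FiniteDimensional ℝ (E [⋀^Fin 1]→L[ℝ] ℝ) :=
    (oneForm (E := E) (F := ℝ)).toLinearEquiv.finiteDimensional
  have : CompleteSpace (E [⋀^Fin 1]→L[ℝ] ℝ) := FiniteDimensional.complete ℝ _
  obtain ⟨v, hv⟩ := exists_ne (0 : E)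
  obtain ⟨b, hbv⟩ := SeparatingDual.exists_eq_one (R := ℝ) hv
  have hinv : ∀ᶠ z in 𝓝 x, (α z).curryLeft.IsInvertible :=
    eventually_isInvertible hα.curryLeft.continuousAt hx
  let X : E → E := fun z => (α z).curryLeft.inverse (oneForm b)
  have hXb : ∀ᶠ z in 𝓝 x, (α z).curryLeft (X z) = oneForm b :=
    hinv.mono fun z hz => hz.self_apply_inverse _
  have hX : SmoothNear X x := (hα.curryLeft.inverse hx).clm_apply (.const _)
  have hX0 : X x ≠ 0 := fun h => by
    have hb : b = 0 := oneForm.injective (by rw [← hXb.self_of_nhds, h, map_zero, map_zero])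
    exact zero_ne_one (α := ℝ) (by rw [← hbv, hb]; rfl)
  obtain ⟨u, hu, huX⟩ := hX.exists_time_function hX0
  obtain ⟨Y, hY, hdual⟩ := exists_isDualPair hx hXb.self_of_nhds huX.self_of_nhds
  refine ⟨u, b, X x, Y, hu, hdual, hdual.curryLeft_sub_wedge_fst hXb.self_of_nhds hY,
    hdual.curryLeft_sub_wedge_snd hXb.self_of_nhds hY, ?_⟩
  filter_upwards [hinv, hXb, huX] with z hz hXz huz
  obtain ⟨Y', hY', hdual'⟩ := exists_isDualPair hz hXz huz
  exact hdual'.formRank_sub_wedge hz hXz hY'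

theorem ClosedNear.rectifiable_of_two_form {E : Type*} [NormedAddCommGroup E] [NormedSpace ℝ E]
    [FiniteDimensional ℝ E] {α : E → E [⋀^Fin 2]→L[ℝ] ℝ} {x : E} (hα : ClosedNear α x)
    (hrank : ∀ᶠ z in 𝓝 x, formRank (α z) = formRank (α x)) : Rectifiable α x := by
  induction hE : Module.finrank ℝ E generalizing E with
  | zero =>
    have : Subsingleton E := Module.finrank_zero_iff.1 hE
    exact .of_eventuallyEq_const (Eventually.of_forall fun z => congrArg α (Subsingleton.elim z x))
  | succ n ih =>
    have degenerate : ∀ {β : E → E [⋀^Fin 2]→L[ℝ] ℝ}, ClosedNear β x →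
        (∀ᶠ z in 𝓝 x, formRank (β z) = formRank (β x)) →
        ∀ {v : E}, v ≠ 0 → (β x).curryLeft v = 0 → Rectifiable β x :=
      fun hβ hβr _ hv0 hv => hβ.rectifiable_of_kernel hβr hv0 hv fun K γ y hK hγ hγr =>
        ih hγ (hγr.mono fun _ h => h.trans hγr.self_of_nhds.symm) (by omega)
    by_cases hker : ∃ v, v ≠ 0 ∧ (α x).curryLeft v = 0
    · obtain ⟨v, hv0, hv⟩ := hker
      exact degenerate hα hrank hv0 hv
    have : Nontrivial E := Module.nontrivial_of_finrank_pos (R := ℝ) (by omega)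
    obtain ⟨u, b, X, Y, hu, hdual, hX, hY, hβr⟩ := hα.smoothNear.exists_hyperbolic_splitting
      (isInvertible_curryLeft fun v hv => by_contra fun hv0 => hker ⟨v, hv0, hv⟩)
    have hX0 : X ≠ 0 := fun h => zero_ne_one (α := ℝ) (by rw [← hdual.fst_fst, h, map_zero])
    have hβ := degenerate (hα.sub (hu.closedNear_wedge_fderiv b))
      (hβr.mono fun z hz => by have := hβr.self_of_nhds; omega) hX0 hX
    simpa only [sub_add_cancel] using hβ.add_wedge_fderiv hu hdual hX hY

end Darboux

/-- The kernel of an alternating form: the vectors that make it vanish when inserted in any one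
of its arguments. It is the whole space for a form of degree zero. -/
def formKernel {𝕜 V U ι : Type*} [Field 𝕜] [AddCommGroup V] [Module 𝕜 V] [TopologicalSpace V]
    [AddCommGroup U] [Module 𝕜 U] [TopologicalSpace U] [DecidableEq ι]
    (c : V [⋀^ι]→L[𝕜] U) : Submodule 𝕜 V where
  carrier := {v | ∀ w i, c (Function.update w i v) = 0}
  add_mem' h h' w i := by rw [c.map_update_add, h, h', add_zero]
  zero_mem' w i := c.map_coord_zero i (Function.update_self i 0 w)
  smul_mem' t _ h w i := by rw [c.map_update_smul, h, smul_zero]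

section ConstantRank

theorem finrank_formKernel_compContinuousLinearMap {𝕜 V W U ι : Type*} [Field 𝕜] [AddCommGroup V]
    [Module 𝕜 V] [TopologicalSpace V] [AddCommGroup W] [Module 𝕜 W] [TopologicalSpace W]
    [AddCommGroup U] [Module 𝕜 U] [TopologicalSpace U] [DecidableEq ι] (c : W [⋀^ι]→L[𝕜] U)
    (L : V ≃L[𝕜] W) :
    Module.finrank 𝕜 (formKernel (c.compContinuousLinearMap (L : V →L[𝕜] W))) =
      Module.finrank 𝕜 (formKernel c) := by
  have hcomap : formKernel (c.compContinuousLinearMap (L : V →L[𝕜] W)) =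
      (formKernel c).comap (L.toLinearEquiv : V →ₗ[𝕜] W) := by
    ext v
    have hupdate : ∀ (w : ι → V) i, L ∘ Function.update w i v = Function.update (L ∘ w) i (L v) :=
      fun w i => Function.comp_update L w i v
    refine ⟨fun h w i => ?_, fun h w i => (congrArg c (hupdate w i)).trans (h (L ∘ w) i)⟩
    have hw : L ∘ L.symm ∘ w = w := funext fun k => L.apply_symm_apply (w k)
    refine Eq.trans ?_ (h (L.symm ∘ w) i)
    exact (congrArg c ((hupdate (L.symm ∘ w) i).trans (by rw [hw]; rfl))).symm
  rw [hcomap]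
  exact (L.toLinearEquiv.ofSubmodule' (formKernel c)).finrank_eq

theorem formKernel_eq_ker_curryLeft {𝕜 V U : Type*} [NontriviallyNormedField 𝕜]
    [NormedAddCommGroup V] [NormedSpace 𝕜 V] [NormedAddCommGroup U] [NormedSpace 𝕜 U] {q : ℕ}
    (c : V [⋀^Fin (q + 1)]→L[𝕜] U) :
    formKernel c = LinearMap.ker (c.curryLeft : V →ₗ[𝕜] V [⋀^Fin q]→L[𝕜] U) := by
  ext v
  refine ⟨fun h => ?_, fun h w i => apply_eq_zero_of_curryLeft_eq_zero c (k := i) ?_⟩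
  · ext w
    exact (congrArg c (Fin.update_cons_zero 0 w v).symm).trans (h (Fin.cons 0 w) 0)
  · rw [Function.update_self]
    exact h

theorem formRank_add_finrank_formKernel {𝕜 V U : Type*} [NontriviallyNormedField 𝕜]
    [NormedAddCommGroup V] [NormedSpace 𝕜 V] [FiniteDimensional 𝕜 V] [NormedAddCommGroup U]
    [NormedSpace 𝕜 U] {q : ℕ} (c : V [⋀^Fin (q + 1)]→L[𝕜] U) :
    formRank c + Module.finrank 𝕜 (formKernel c) = Module.finrank 𝕜 V := by
  rw [formKernel_eq_ker_curryLeft]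
  exact LinearMap.finrank_range_add_finrank_ker _

theorem ClosedNear.rectifiable_of_zero_form {α : E → E [⋀^Fin 0]→L[ℝ] F} {x : E}
    (hα : ClosedNear α x) : Rectifiable α x := by
  obtain ⟨r, hr, hball⟩ := Metric.eventually_nhds_iff_ball.1
    (hα.smoothNear.eventually_differentiableAt.and hα.extDeriv_eq_zero)
  have hfderiv : ∀ z ∈ Metric.ball x r, fderiv ℝ α z = 0 := fun z hz => by
    ext v w
    have hd := DFunLike.congr_fun (hball z hz).2 fun _ => v
    rw [extDeriv, ContinuousAlternatingMap.alternatizeUncurryFin_apply] at hd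
    rw [Subsingleton.elim w (Fin.removeNth 0 fun _ : Fin 1 => v)]
    simpa using hd
  refine .of_eventuallyEq_const (c := α x) ?_
  filter_upwards [Metric.ball_mem_nhds x hr] with z hz
  exact Metric.isOpen_ball.is_const_of_fderiv_eq_zero (convex_ball x r).isPreconnected
    (fun y hy => (hball y hy).1.differentiableWithinAt) hfderiv hz (Metric.mem_ball_self hr)

theorem ClosedNear.rectifiable [FiniteDimensional ℝ E] {q : ℕ}
    (hq : q = 0 ∨ q = 1 ∨ q = 2 ∨ q + 1 = Module.finrank ℝ E ∨ q = Module.finrank ℝ E)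
    {α : E → E [⋀^Fin q]→L[ℝ] ℝ} {x : E} (hα : ClosedNear α x)
    (hker : ∀ᶠ z in 𝓝 x,
      Module.finrank ℝ (formKernel (α z)) = Module.finrank ℝ (formKernel (α x))) :
    Rectifiable α x := by
  cases q with
  | zero => exact hα.rectifiable_of_zero_form
  | succ q =>
    have hrank : ∀ᶠ z in 𝓝 x, formRank (α z) = formRank (α x) := by
      filter_upwards [hker] with z hz
      linarith [formRank_add_finrank_formKernel (α z), formRank_add_finrank_formKernel (α x)]
    by_cases hx : α x = 0
    · refine .of_eventuallyEq_const (c := 0) (hrank.mono fun z hz => formRank_eq_zero_iff.1 ?_)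
      rw [hz, hx, formRank_eq_zero_iff]
    rcases hq with hq | hq | hq | hq | hq
    · exact absurd hq q.succ_ne_zero
    · obtain rfl : q = 0 := by omega
      exact hα.rectifiable_of_one_form hx
    · obtain rfl : q = 1 := by omega
      exact hα.rectifiable_of_two_form hrank
    · exact hα.rectifiable_of_codegree_one hrank hx hq.symm
    · exact .of_top_form hα.smoothNear hx hq.symm

end ConstantRank

section Charts

variable {n q : ℕ}

theorem Rectifiable.exists_openPartialHomeomorph [CompleteSpace E] {ι : Type*}
    {α : E → E [⋀^ι]→L[ℝ] F} {x : E} (h : Rectifiable α x) :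
    ∃ (e : OpenPartialHomeomorph E E) (c : E [⋀^ι]→L[ℝ] F), x ∈ e.source ∧
      ContDiffOn ℝ ∞ e e.source ∧ ContDiffOn ℝ ∞ e.symm e.target ∧
      ∀ y ∈ e.target, (α (e.symm y)).compContinuousLinearMap (fderiv ℝ e.symm y) = c := by
  obtain ⟨Ψ, c, hΨ, hinv, hα⟩ := h
  obtain ⟨e₀, hx, rfl, he, hsymm⟩ := hΨ.exists_openPartialHomeomorph hinv
  obtain ⟨U, hU, hUo, hxU⟩ := eventually_nhds_iff.1 hα
  let e := e₀.restrOpen U hUo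
  refine ⟨e, c, ⟨hx, hxU⟩, he.mono fun _ hz => hz.1, hsymm.mono fun _ hy => hy.1, fun y hy => ?_⟩
  have hz : e.symm y ∈ e.source := e.map_target hy
  have hde : HasFDerivAt e₀ (fderiv ℝ e₀ (e.symm y)) (e.symm y) :=
    ((he.contDiffAt (e₀.open_source.mem_nhds hz.1)).differentiableAt (by simp)).hasFDerivAt
  have hdsymm : HasFDerivAt e.symm (fderiv ℝ e.symm y) y :=
    ((hsymm.contDiffAt (e₀.open_target.mem_nhds hy.1)).differentiableAt (by simp)).hasFDerivAt
  have hid : (fderiv ℝ e₀ (e.symm y)).comp (fderiv ℝ e.symm y) = .id ℝ E :=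
    ((hde.comp y hdsymm).congr_of_eventuallyEq (f₁ := id)
      ((e.eventually_right_inverse hy).mono fun _ h => h.symm)).unique (hasFDerivAt_id y)
  rw [hU _ hz.2, formPullback]
  ext w
  exact congrArg c (funext fun i => DFunLike.congr_fun hid (w i))

variable {M : Type*} [TopologicalSpace M] [ChartedSpace (EuclideanSpace ℝ (Fin n)) M]
  {φ : OpenPartialHomeomorph M (EuclideanSpace ℝ (Fin n))}
  {e : OpenPartialHomeomorph (EuclideanSpace ℝ (Fin n)) (EuclideanSpace ℝ (Fin n))}

theorem trans_mem_maximalAtlas [IsManifold (𝓡 n) ∞ M]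
    (hφ : φ ∈ IsManifold.maximalAtlas (𝓡 n) ∞ M)
    (he : ContDiffOn ℝ ∞ e e.source) (hsymm : ContDiffOn ℝ ∞ e.symm e.target) :
    φ.trans e ∈ IsManifold.maximalAtlas (𝓡 n) ∞ M := by
  refine (φ.trans e).mem_maximalAtlas_of_contMDiffOn ?_ ?_
  · exact he.contMDiffOn.comp
      ((contMDiffOn_of_mem_maximalAtlas hφ).mono fun _ hz => hz.1) fun _ hz => hz.2
  · exact (contMDiffOn_symm_of_mem_maximalAtlas hφ).comp
      (hsymm.contMDiffOn.mono fun _ hy => hy.1) fun _ hy => hy.2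

namespace FormField

theorem inCoordinates_trans (ζ : FormField n q M) (hφ : φ ∈ IsManifold.maximalAtlas (𝓡 n) ∞ M)
    (hsymm : ContDiffOn ℝ ∞ e.symm e.target) {y : EuclideanSpace ℝ (Fin n)}
    (hy : y ∈ (φ.trans e).target) :
    ζ.inCoordinates (φ.trans e) y =
      (ζ.inCoordinates φ (e.symm y)).compContinuousLinearMap (fderiv ℝ e.symm y) := by
  have hφd : MDifferentiableAt (𝓡 n) (𝓡 n) φ.symm (e.symm y) :=
    (contMDiffAt_symm_of_mem_maximalAtlas hφ hy.2).mdifferentiableAt (by simp)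
  have hed : DifferentiableAt ℝ e.symm y :=
    (hsymm.contDiffAt (e.open_target.mem_nhds hy.1)).differentiableAt (by simp)
  have hchain : mfderiv (𝓡 n) (𝓡 n) (φ.trans e).symm y =
      (mfderiv (𝓡 n) (𝓡 n) φ.symm (e.symm y)).comp (fderiv ℝ e.symm y) :=
    (mfderiv_comp y hφd hed.mdifferentiableAt).trans (by rw [mfderiv_eq_fderiv]; rfl)
  rw [inCoordinates, hchain]
  rfl

theorem exists_chart_of_rectifiable [IsManifold (𝓡 n) ∞ M] {ζ : FormField n q M} {x : M}
    (hφ : φ ∈ IsManifold.maximalAtlas (𝓡 n) ∞ M) (hx : x ∈ φ.source)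
    (h : Rectifiable (ζ.inCoordinates φ) (φ x)) :
    ∃ ψ ∈ IsManifold.maximalAtlas (𝓡 n) ∞ M, x ∈ ψ.source ∧
      ∀ i : Fin q → Fin n, ∃ c : ℝ, ∀ y ∈ ψ.target, ζ.component ψ i y = c := by
  obtain ⟨e, c, hxe, he, hsymm, hc⟩ := h.exists_openPartialHomeomorph
  refine ⟨φ.trans e, trans_mem_maximalAtlas hφ he hsymm, ⟨hx, hxe⟩, fun i =>
    ⟨c fun k => EuclideanSpace.single (i k) 1, fun y hy => ?_⟩⟩
  rw [component, ζ.inCoordinates_trans hφ hsymm hy, hc y hy.1]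

theorem IsSmooth.closedNear {ζ : FormField n q M} (hζ : ζ.IsSmooth) (hclosed : ζ.IsClosed)
    (hφ : φ ∈ IsManifold.maximalAtlas (𝓡 n) ∞ M) {y : EuclideanSpace ℝ (Fin n)}
    (hy : y ∈ φ.target) : ClosedNear (ζ.inCoordinates φ) y where
  smoothNear := (φ.open_target.eventually_mem hy).mono fun _ hz =>
    (hζ φ hφ).contDiffAt (φ.open_target.mem_nhds hz)
  extDeriv_eq_zero := (φ.open_target.eventually_mem hy).mono fun z hz => hclosed φ hφ z hz

theorem finrank_formKernel_inCoordinates (ζ : FormField n q M)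
    (hφ : φ ∈ IsManifold.maximalAtlas (𝓡 n) ∞ M) {y : EuclideanSpace ℝ (Fin n)}
    (hy : y ∈ φ.target) :
    Module.finrank ℝ (formKernel (ζ.inCoordinates φ y)) =
      Module.finrank ℝ (formKernel (ζ (φ.symm y))) := by
  have hφd : φ.MDifferentiable (𝓡 n) (𝓡 n) :=
    ⟨(contMDiffOn_of_mem_maximalAtlas hφ).mdifferentiableOn (by simp),
      (contMDiffOn_symm_of_mem_maximalAtlas hφ).mdifferentiableOn (by simp)⟩
  exact finrank_formKernel_compContinuousLinearMap _ (hφd.symm.mfderiv hy)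

theorem IsAlgebraicallyConstant.finrank_formKernel_eq {ζ : FormField n q M}
    (hζ : ζ.IsAlgebraicallyConstant) (x y : M) :
    Module.finrank ℝ (formKernel (ζ x)) = Module.finrank ℝ (formKernel (ζ y)) := by
  obtain ⟨L, hL⟩ := hζ x y
  rw [← hL, finrank_formKernel_compContinuousLinearMap]

end FormField

end Charts

end NormedSpace

theorem propositionD_general (n q : ℕ) (hq : q = 0 ∨ q = 1 ∨ q = 2 ∨ q + 1 = n ∨ q = n)
    (M : Type*) [TopologicalSpace M] [ChartedSpace (EuclideanSpace ℝ (Fin n)) M]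
    [IsManifold (𝓡 n) ∞ M] (ζ : FormField n q M) (hsmooth : ζ.IsSmooth)
    (hrank : ∀ x, ∀ᶠ y in 𝓝 x,
      Module.finrank ℝ (formKernel (ζ y)) = Module.finrank ℝ (formKernel (ζ x)))
    (hclosed : ζ.IsClosed) :
    ζ.IsLocallyConstant := by
  intro x
  set φ := chartAt (EuclideanSpace ℝ (Fin n)) x
  have hφ : φ ∈ IsManifold.maximalAtlas (𝓡 n) ∞ M := IsManifold.chart_mem_maximalAtlas x
  have hx : x ∈ φ.source := mem_chart_source _ x
  have hy : φ x ∈ φ.target := φ.map_source hx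
  refine FormField.exists_chart_of_rectifiable hφ hx
    ((hsmooth.closedNear hclosed hφ hy).rectifiable (by simpa using hq) ?_)
  have hsymm : Tendsto φ.symm (𝓝 (φ x)) (𝓝 x) := φ.tendsto_symm hx
  filter_upwards [φ.open_target.eventually_mem hy, hsymm.eventually (hrank x)] with z hz hrz
  rw [ζ.finrank_formKernel_inCoordinates hφ hz, ζ.finrank_formKernel_inCoordinates hφ hy, hrz,
    φ.left_inv hx]

theorem propositionD (n q : ℕ) (hq : q = 0 ∨ q = 1 ∨ q = 2 ∨ q + 1 = n ∨ q = n)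
    (M : Type*) [TopologicalSpace M] [ChartedSpace (EuclideanSpace ℝ (Fin n)) M]
    [IsManifold (𝓡 n) ∞ M]
    (ζ : FormField n q M) (hsmooth : ζ.IsSmooth) (hconst : ζ.IsAlgebraicallyConstant)
    (hclosed : ζ.IsClosed) :
    ζ.IsLocallyConstant :=
  propositionD_general n q hq M ζ hsmooth
    (fun x => .of_forall fun y => hconst.finrank_formKernel_eq y x) hclosed
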